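/- For $n\ge 0$ let $N=2^n$. In the Quantum-Locked Estimation problem $\mathrm{QLE}_n$ the input is a pair $(f,X)$ of black boxes, $f:\{0,1\}^n\to\{0,1\}^n$ and $X\in\{0,1\}^N$, with the promise that there is a string $s\in\{0,1\}^n$ such that for all $x,y$, $f(x)=f(y)\iff x=y\text{ or }x=y\oplus s$, and such that $s$, read as an $n$-bit binary number, satisfies $\big|\,|X|-s\,\big|\le 0.09\,N$, where $|X|$ is the Hamming weight of $X$. The goal is to output an integer $t\in\{0,\dots,N-1\}$ with $\big|\,|X|-t\,\big|\le N/10$. A query is one query to $f$ (returning the string $f(x)$) or one query to $X$ (returning the bit $X_i$); a quantum query is one use of $|x\rangle|y\rangle\mapsto|x\rangle|y\oplus f(x)\rangle$ or of $|i\rangle|b\rangle\mapsto|i\rangle|b\oplus X_i\rangle$; the cost of an algorithm is its worst-case total number of queries. An algorithm solves a problem if on every promised input it outputs a correct solution with probability at least $2/3$; it is pseudo-deterministic if there is a function $g$ such that, on every promised input $I$, $g(I)$ is a correct solution and is output with probability at least $2/3$. Let $\mathsf R$, $\mathsf{psR}$, $\mathsf{psQ}$ denote the randomized, the classical pseudo-deterministic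 and the quantum pseudo-deterministic query complexity. A pseudo-deterministic algorithm computing $g$ canonizes a randomized algorithm $\mathcal A$ if on every promised input $I$ the probability that $\mathcal A$ outputs $g(I)$ is greater than the probability that $\mathcal A$ outputs an incorrect solution. Theorem. As functions of $N=2^n$: 1. $\mathsf R(\mathrm{QLE}_n)=O(1)$; 2. $\mathsf{psQ}(\mathrm{QLE}_n)=O(\log N)$; 3. $\mathsf{psR}(\mathrm{QLE}_n)=\Omega(\sqrt N)$. Furthermore, there exist a classical randomized algorithm $\mathcal A$ solving $\mathrm{QLE}_n$ with $O(\log N)$ queries and a pseudo-deterministic quantum algorithm $\mathcal B$ for $\mathrm{QLE}_n$ with $O(\log N)$ queries such that $\mathcal B$ canonizes $\mathcal A$. -/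

import Mathlib

open scoped ENNReal
open Filter

noncomputable section

/-! ### Inputs and search problems -/

/-- A pair `(f, X)` of black boxes: a function `f : {0,1}^n → {0,1}^n` and a string
`X ∈ {0,1}^N`, where `N = 2^n`. -/
structure OracleInput (n : ℕ) where
  f : BitVec n → BitVec n
  X : Fin (2 ^ n) → Bool

/-- A (promise) search problem over such pairs: `domain` is the set of inputs that satisfy the
promise and `rel I y` says that `y` is a correct solution on input `I`. -/
structure SearchProblem (n : ℕ) (Y : Type) where
  domain : Set (OracleInput n)
  rel : OracleInput n → Y → Prop

/-! ### Classical query algorithms -/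

/-- Deterministic query algorithms: adaptive decision trees. A query to `f` returns the whole
string `f x`, a query to `X` returns the bit `X i`. -/
inductive DTree (n : ℕ) (Y : Type) : Type
  | output (y : Y) : DTree n Y
  | queryF (x : BitVec n) (next : BitVec n → DTree n Y) : DTree n Y
  | queryX (i : Fin (2 ^ n)) (next : Bool → DTree n Y) : DTree n Y

/-- The output of a decision tree on the input `I`. -/
def DTree.run {n : ℕ} {Y : Type} (I : OracleInput n) : DTree n Y → Y
  | .output y => y
  | .queryF x next => (next (I.f x)).run I
  | .queryX i next => (next (I.X i)).run I

/-- The worst-case number of queries of a decision tree. -/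
def DTree.depth {n : ℕ} {Y : Type} : DTree n Y → ℕ
  | .output _ => 0
  | .queryF _ next => 1 + Finset.univ.sup fun v => (next v).depth
  | .queryX _ next => 1 + Finset.univ.sup fun v => (next v).depth

/-- A randomized query algorithm is a probability distribution over decision trees. -/
abbrev RandAlg (n : ℕ) (Y : Type) : Type := PMF (DTree n Y)

/-- The probability that the output of `A` on input `I` lies in `S`. -/
def RandAlg.prob {n : ℕ} {Y : Type} (A : RandAlg n Y) (I : OracleInput n) (S : Set Y) : ℝ :=
  (A.toOuterMeasure {T | T.run I ∈ S}).toReal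

/-- `A` never makes more than `q` queries. -/
def RandAlg.QueriesAtMost {n : ℕ} {Y : Type} (A : RandAlg n Y) (q : ℕ) : Prop :=
  ∀ T ∈ A.support, T.depth ≤ q

/-! ### Quantum query algorithms -/

/-- Computational basis of the state space: an address and an answer register for `f`, an
address and an answer register for `X`, and a finite workspace `W`. -/
abbrev QBasis (n : ℕ) (W : Type) : Type :=
  (BitVec n × BitVec n) × (Fin (2 ^ n) × Bool) × W

/-- A gate of a quantum query circuit: a unitary that is independent of the input, or one use of
one of the two oracle unitaries. -/
inductive QGate (n : ℕ) (W : Type) [Fintype W] [DecidableEq W] : Type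
  | unitary (U : Matrix.unitaryGroup (QBasis n W) ℂ) : QGate n W
  | queryF : QGate n W
  | queryX : QGate n W

/-- The action on basis states `|x⟩|y⟩ ↦ |x⟩|y ⊕ f x⟩` of the oracle for `f`. -/
def oracleF {n : ℕ} {W : Type} (I : OracleInput n) : QBasis n W → QBasis n W :=
  fun ((x, y), (i, b), w) => ((x, y ^^^ I.f x), (i, b), w)

/-- The action on basis states `|i⟩|b⟩ ↦ |i⟩|b ⊕ X i⟩` of the oracle for `X`. -/
def oracleX {n : ℕ} {W : Type} (I : OracleInput n) : QBasis n W → QBasis n W :=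
  fun ((x, y), (i, b), w) => ((x, y), (i, b ^^ I.X i), w)

/-- The matrix of a gate when the input is `I`. -/
def QGate.toMatrix {n : ℕ} {W : Type} [Fintype W] [DecidableEq W] (I : OracleInput n) :
    QGate n W → Matrix (QBasis n W) (QBasis n W) ℂ
  | .unitary U => U.1
  | .queryF => Matrix.of fun b' b => if b' = oracleF I b then 1 else 0
  | .queryX => Matrix.of fun b' b => if b' = oracleX I b then 1 else 0

/-- The number of queries made by a gate. -/
def QGate.cost {n : ℕ} {W : Type} [Fintype W] [DecidableEq W] : QGate n W → ℕ
  | .unitary _ => 0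
  | .queryF => 1
  | .queryX => 1

/-- A quantum query algorithm: it starts in a fixed basis state, applies a circuit of gates (the
head of the list first), measures in the computational basis and outputs a function of the
measurement result. -/
structure QuantumAlg (n : ℕ) (Y : Type) where
  W : Type
  [fintypeW : Fintype W]
  [decEqW : DecidableEq W]
  start : QBasis n W
  circuit : List (QGate n W)
  out : QBasis n W → Y

attribute [instance] QuantumAlg.fintypeW QuantumAlg.decEqW

/-- The state before the measurement, on input `I`. -/
def QuantumAlg.finalState {n : ℕ} {Y : Type} (B : QuantumAlg n Y) (I : OracleInput n) :
    QBasis n B.W → ℂ :=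
  B.circuit.foldl (fun ψ g => (g.toMatrix I).mulVec ψ) (Pi.single B.start 1)

open Classical in
/-- The probability that the output of `B` on input `I` lies in `S`. -/
def QuantumAlg.prob {n : ℕ} {Y : Type} (B : QuantumAlg n Y) (I : OracleInput n) (S : Set Y) : ℝ :=
  ∑ b : QBasis n B.W, if B.out b ∈ S then ‖B.finalState I b‖ ^ 2 else 0

/-- The total number of queries (to `f` or to `X`) made by `B`. -/
def QuantumAlg.queries {n : ℕ} {Y : Type} (B : QuantumAlg n Y) : ℕ :=
  (B.circuit.map QGate.cost).sum

/-! ### Solving, pseudo-determinism, canonization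

The notions below depend on an algorithm only through its output probabilities
`pr I S = ℙ[output on input I lies in S]`. -/

/-- Bounded-error solution of a search problem. -/
def SearchProblem.Solves {n : ℕ} {Y : Type} (P : SearchProblem n Y)
    (pr : OracleInput n → Set Y → ℝ) : Prop :=
  ∀ I ∈ P.domain, 2 / 3 ≤ pr I {y | P.rel I y}

/-- Pseudo-deterministic solution of a search problem with canonical solution function `g`. -/
def SearchProblem.PsSolvesWith {n : ℕ} {Y : Type} (P : SearchProblem n Y)
    (pr : OracleInput n → Set Y → ℝ) (g : P.domain → Y) : Prop :=
  ∀ I : P.domain, P.rel I (g I) ∧ 2 / 3 ≤ pr I {g I}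

/-- Pseudo-deterministic solution of a search problem. -/
def SearchProblem.PsSolves {n : ℕ} {Y : Type} (P : SearchProblem n Y)
    (pr : OracleInput n → Set Y → ℝ) : Prop :=
  ∃ g : P.domain → Y, P.PsSolvesWith pr g

/-- The function `g` canonizes the randomized algorithm `A`: on every input, `A` outputs the value
of `g` with greater probability than it outputs an incorrect solution. -/
def SearchProblem.FunCanonizes {n : ℕ} {Y : Type} (P : SearchProblem n Y)
    (g : P.domain → Y) (A : RandAlg n Y) : Prop :=
  ∀ I : P.domain, A.prob I {y | ¬ P.rel I y} < A.prob I {g I}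

/-- The quantum algorithm `B` is pseudo-deterministic for `P` and the function that it computes
canonizes the randomized algorithm `A`. -/
def SearchProblem.Canonizes {n : ℕ} {Y : Type} (P : SearchProblem n Y)
    (B : QuantumAlg n Y) (A : RandAlg n Y) : Prop :=
  ∃ g : P.domain → Y, P.PsSolvesWith B.prob g ∧ P.FunCanonizes g A

/-! ### Complexity measures (`⊤` if there is no algorithm) -/

/-- Randomized bounded-error query complexity. -/
def SearchProblem.R {n : ℕ} {Y : Type} (P : SearchProblem n Y) : ℕ∞ :=
  ⨅ (q : ℕ) (_ : ∃ A : RandAlg n Y, A.QueriesAtMost q ∧ P.Solves A.prob), (q : ℕ∞)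

/-- Classical pseudo-deterministic query complexity. -/
def SearchProblem.psR {n : ℕ} {Y : Type} (P : SearchProblem n Y) : ℕ∞ :=
  ⨅ (q : ℕ) (_ : ∃ A : RandAlg n Y, A.QueriesAtMost q ∧ P.PsSolves A.prob), (q : ℕ∞)

/-- Quantum pseudo-deterministic query complexity. -/
def SearchProblem.psQ {n : ℕ} {Y : Type} (P : SearchProblem n Y) : ℕ∞ :=
  ⨅ (q : ℕ) (_ : ∃ B : QuantumAlg n Y, B.queries ≤ q ∧ P.PsSolves B.prob), (q : ℕ∞)

/-! ### Quantum-Locked Estimation -/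

/-- `f` is a Simon function with secret string `s`. -/
def IsSimon {n : ℕ} (f : BitVec n → BitVec n) (s : BitVec n) : Prop :=
  ∀ x y : BitVec n, f x = f y ↔ x = y ∨ x = y ^^^ s

/-- The Hamming weight of `X`. -/
def hammingWeight {n : ℕ} (X : Fin (2 ^ n) → Bool) : ℕ :=
  (Finset.univ.filter fun i => X i = true).card

/-- The problem Quantum-Locked Estimation with length parameter `N = 2^n`. Promise: `f` is a Simon
function whose secret, read as a binary number, is within `0.09 N` of the Hamming weight of `X`.
Goal: a number `t` with `0 ≤ t < N` within `N / 10` of the Hamming weight of `X`. -/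
def quantumLockedEstimation (n : ℕ) : SearchProblem n (Fin (2 ^ n)) where
  domain := {I | ∃ s : BitVec n, IsSimon I.f s ∧
    |(hammingWeight I.X : ℝ) - (s.toNat : ℝ)| ≤ 9 / 100 * (2 : ℝ) ^ n}
  rel I t := |(hammingWeight I.X : ℝ) - ((t : ℕ) : ℝ)| ≤ (2 : ℝ) ^ n / 10

end

noncomputable section

/-! ### Concentration of the mean of uniform samples -/

/-- Upper tail of a sum of `k` independent uniform samples of a centred function with values
in `[-1, 1]`. -/
theorem card_sum_samples_gt_le {ι : Type*} [Fintype ι] (v : ι → ℝ) (hv : ∀ i, |v i| ≤ 1)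
    (h0 : ∑ i, v i = 0) (k : ℕ) {δ : ℝ} (hδ0 : 0 ≤ δ) (hδ1 : δ ≤ 1) :
    ((Finset.univ.filter fun φ : Fin k → ι => k * δ < ∑ j, v (φ j)).card : ℝ)
      ≤ (Fintype.card ι : ℝ) ^ k * Real.exp (-(k * δ ^ 2 / 4)) := by
  classical
  set l : ℝ := δ / 2 with hl
  have hexp : ∀ i, Real.exp (l * v i) ≤ 1 + l * v i + l ^ 2 := by
    intro i
    have h1 : |l * v i| ≤ l := by
      rw [abs_mul, abs_of_nonneg (by positivity)]
      exact mul_le_of_le_one_right (by positivity) (hv i)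
    have h2 := Real.abs_exp_sub_one_sub_id_le (x := l * v i) (by linarith)
    have h3 : (l * v i) ^ 2 ≤ l ^ 2 := by
      rw [← sq_abs (l * v i)]
      exact pow_le_pow_left₀ (abs_nonneg _) h1 2
    have h4 := (abs_le.mp h2).2
    linarith
  have hmgf : ∑ i, Real.exp (l * v i) ≤ Fintype.card ι * Real.exp (l ^ 2) := by
    calc ∑ i, Real.exp (l * v i) ≤ ∑ i, (1 + l * v i + l ^ 2) :=
          Finset.sum_le_sum fun i _ => hexp i
      _ = Fintype.card ι * (1 + l ^ 2) := by
          simp only [Finset.sum_add_distrib, ← Finset.mul_sum, h0]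
          simp [mul_add]
      _ ≤ _ := by
          gcongr
          linarith [Real.add_one_le_exp (l ^ 2)]
  have hsum : ∑ φ : Fin k → ι, Real.exp (l * ∑ j, v (φ j))
      ≤ (Fintype.card ι * Real.exp (l ^ 2)) ^ k := by
    calc ∑ φ : Fin k → ι, Real.exp (l * ∑ j, v (φ j))
        = ∑ φ : Fin k → ι, ∏ j, Real.exp (l * v (φ j)) := by
          simp only [Finset.mul_sum, Real.exp_sum]
      _ = (∑ i, Real.exp (l * v i)) ^ k := by rw [Fintype.sum_pow]
      _ ≤ _ := by
          gcongr
  have hmarkov : ((Finset.univ.filter fun φ : Fin k → ι => k * δ < ∑ j, v (φ j)).card : ℝ)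
      * Real.exp (l * (k * δ)) ≤ ∑ φ : Fin k → ι, Real.exp (l * ∑ j, v (φ j)) := by
    rw [← nsmul_eq_mul, ← Finset.sum_const]
    refine (Finset.sum_le_sum fun φ hφ => ?_).trans
      (Finset.sum_le_univ_sum_of_nonneg fun φ => (Real.exp_pos _).le)
    rw [Finset.mem_filter] at hφ
    gcongr
    exact hφ.2.le
  have hpos := Real.exp_pos (l * (k * δ))
  refine le_of_mul_le_mul_right ((hmarkov.trans hsum).trans (le_of_eq ?_)) hpos
  rw [mul_pow, ← Real.exp_nat_mul, mul_assoc, ← Real.exp_add]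
  congr 2
  rw [hl]; ring

/-- Two-sided tail of a sum of uniform samples. -/
theorem card_abs_sum_samples_gt_le {ι : Type*} [Fintype ι] (v : ι → ℝ) (hv : ∀ i, |v i| ≤ 1)
    (h0 : ∑ i, v i = 0) (k : ℕ) {δ : ℝ} (hδ0 : 0 ≤ δ) (hδ1 : δ ≤ 1) :
    ((Finset.univ.filter fun φ : Fin k → ι => k * δ < |∑ j, v (φ j)|).card : ℝ)
      ≤ (Fintype.card ι : ℝ) ^ k * (2 * Real.exp (-(k * δ ^ 2 / 4))) := by
  classical
  have h1 := card_sum_samples_gt_le v hv h0 k hδ0 hδ1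
  have h2 := card_sum_samples_gt_le (fun i => - v i) (by simpa using hv) (by simpa using h0)
    k hδ0 hδ1
  have h3 : (Finset.univ.filter fun φ : Fin k → ι => k * δ < |∑ j, v (φ j)|) ⊆
      (Finset.univ.filter fun φ : Fin k → ι => k * δ < ∑ j, v (φ j)) ∪
      (Finset.univ.filter fun φ : Fin k → ι => k * δ < ∑ j, - v (φ j)) := by
    intro φ
    simp [lt_abs]
  have h4 := (Finset.card_le_card h3).trans (Finset.card_union_le _ _)
  have h5 : ((Finset.univ.filter fun φ : Fin k → ι => k * δ < |∑ j, v (φ j)|).card : ℝ) ≤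
      (Finset.univ.filter fun φ : Fin k → ι => k * δ < ∑ j, v (φ j)).card +
      (Finset.univ.filter fun φ : Fin k → ι => k * δ < ∑ j, - v (φ j)).card := by
    exact_mod_cast h4
  linarith

/-! ### The sampling algorithm -/

/-- Query `X` at the listed positions and apply `o` to the initial count `c` plus the number of
ones seen. -/
def countTree {n : ℕ} {Y : Type} (o : ℕ → Y) : List (Fin (2 ^ n)) → ℕ → DTree n Y
  | [], c => .output (o c)
  | i :: l, c => .queryX i fun b => countTree o l (c + b.toNat)

theorem countTree_run {n : ℕ} {Y : Type} (o : ℕ → Y) (I : OracleInput n)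
    (l : List (Fin (2 ^ n))) (c : ℕ) :
    (countTree o l c).run I = o (c + (l.map fun i => (I.X i).toNat).sum) := by
  induction l generalizing c with
  | nil => simp [countTree, DTree.run]
  | cons i l ih => simp [countTree, DTree.run, ih, add_assoc]

theorem countTree_depth {n : ℕ} {Y : Type} (o : ℕ → Y) (l : List (Fin (2 ^ n))) (c : ℕ) :
    (countTree o l c).depth ≤ l.length := by
  induction l generalizing c with
  | nil => simp [countTree, DTree.depth]
  | cons i l ih =>
    simp only [countTree, DTree.depth, List.length_cons]
    have : (Finset.univ.sup fun v : Bool => (countTree o l (c + v.toNat)).depth) ≤ l.length :=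
      Finset.sup_le fun v _ => ih _
    omega

/-- The output probability of a randomized algorithm that picks a tree by a uniform seed. -/
theorem prob_uniform_map {n : ℕ} {Y Ω : Type} [Fintype Ω] [Nonempty Ω] (tree : Ω → DTree n Y)
    (I : OracleInput n) (S : Set Y) [DecidablePred fun ω => (tree ω).run I ∈ S] :
    RandAlg.prob ((PMF.uniformOfFintype Ω).map tree) I S =
      ((Finset.univ.filter fun ω => (tree ω).run I ∈ S).card : ℝ) / Fintype.card Ω := by
  classical
  rw [RandAlg.prob, PMF.toOuterMeasure_map_apply, PMF.toOuterMeasure_uniformOfFintype_apply,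
    ENNReal.toReal_div]
  simp [Fintype.card_subtype]

/-- The Hamming weight estimated from `c` ones among `k` samples. -/
def estimate (n k c : ℕ) : ℝ := 2 ^ n * (c / k)

/-- The estimate rounded to the nearest admissible output. -/
def roundedEstimate (n k c : ℕ) : Fin (2 ^ n) :=
  ⟨min ⌊estimate n k c + 1 / 2⌋₊ (2 ^ n - 1), by
    have := Nat.two_pow_pos n
    omega⟩

open Classical in
/-- Output the guess `t` if it is compatible with the estimate, and the rounded estimate
otherwise. -/
def guessOrEstimate (n k : ℕ) (t : Fin (2 ^ n)) (c : ℕ) : Fin (2 ^ n) :=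
  if |((t : ℕ) : ℝ) - estimate n k c| ≤ 19 / 200 * 2 ^ n then t else roundedEstimate n k c

/-- Estimate the Hamming weight of `X` from `k` uniform samples, and output a uniform guess if it
is compatible with the estimate. -/
def samplingAlg (n k : ℕ) : RandAlg n (Fin (2 ^ n)) :=
  (PMF.uniformOfFintype ((Fin k → Fin (2 ^ n)) × Fin (2 ^ n))).map fun ω =>
    countTree (guessOrEstimate n k ω.2) (List.ofFn ω.1) 0

theorem samplingAlg_queriesAtMost (n k : ℕ) : (samplingAlg n k).QueriesAtMost k := by
  intro T hT
  rw [samplingAlg, PMF.support_map] at hT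
  obtain ⟨ω, -, rfl⟩ := hT
  simpa using countTree_depth (guessOrEstimate n k ω.2) (List.ofFn ω.1) 0

/-- The number of ones among the samples `φ`. -/
def sampleCount {n k : ℕ} (X : Fin (2 ^ n) → Bool) (φ : Fin k → Fin (2 ^ n)) : ℕ :=
  ∑ j, (X (φ j)).toNat

theorem countTree_ofFn_run {n k : ℕ} {Y : Type} (o : ℕ → Y) (I : OracleInput n)
    (φ : Fin k → Fin (2 ^ n)) :
    (countTree o (List.ofFn φ) 0).run I = o (sampleCount I.X φ) := by
  rw [countTree_run, zero_add, List.map_ofFn, List.sum_ofFn]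
  rfl

theorem hammingWeight_eq_sum {n : ℕ} (X : Fin (2 ^ n) → Bool) :
    (hammingWeight X : ℝ) = ∑ i, ((X i).toNat : ℝ) := by
  rw [hammingWeight, Finset.card_filter, Nat.cast_sum]
  refine Finset.sum_congr rfl fun i _ => ?_
  cases X i <;> simp

theorem hammingWeight_le {n : ℕ} (X : Fin (2 ^ n) → Bool) : hammingWeight X ≤ 2 ^ n := by
  unfold hammingWeight
  exact (Finset.card_filter_le _ _).trans_eq (by simp)

open Classical in
/-- The sample sequences that give an inaccurate estimate. -/
def badSamples {n : ℕ} (k : ℕ) (X : Fin (2 ^ n) → Bool) : Finset (Fin k → Fin (2 ^ n)) :=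
  Finset.univ.filter fun φ => 1 / 200 * 2 ^ n < |estimate n k (sampleCount X φ) - hammingWeight X|

theorem card_badSamples_le {n k : ℕ} (hk : 0 < k) (X : Fin (2 ^ n) → Bool) :
    ((badSamples k X).card : ℝ) ≤ (2 ^ n) ^ k * (2 * Real.exp (-(k / 160000))) := by
  classical
  have hN : (0 : ℝ) < 2 ^ n := by positivity
  have hk' : (0 : ℝ) < k := by exact_mod_cast hk
  have hw0 : (0 : ℝ) ≤ hammingWeight X / 2 ^ n := by positivity
  have hw1 : (hammingWeight X : ℝ) / 2 ^ n ≤ 1 := by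
    rw [div_le_one hN]
    exact_mod_cast hammingWeight_le X
  have key := card_abs_sum_samples_gt_le
    (fun i => ((X i).toNat : ℝ) - hammingWeight X / 2 ^ n) (fun i => by
      rw [abs_le]
      cases X i <;> simp <;> constructor <;> linarith)
    (by
      rw [Finset.sum_sub_distrib, ← hammingWeight_eq_sum]
      simp; field_simp; simp) k (δ := 1 / 200) (by norm_num) (by norm_num)
  have hE : Real.exp (-(k * (1 / 200 : ℝ) ^ 2 / 4)) = Real.exp (-(k / 160000)) := by
    congr 1; ring
  rw [hE, Fintype.card_fin] at key
  push_cast at key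
  refine le_trans ?_ key
  rw [Nat.cast_le]
  refine Finset.card_le_card fun φ hφ => ?_
  rw [badSamples, Finset.mem_filter] at hφ
  rw [Finset.mem_filter]
  refine ⟨Finset.mem_univ _, ?_⟩
  have h := hφ.2
  have he : ∑ j, (((X (φ j)).toNat : ℝ) - hammingWeight X / 2 ^ n) =
      k / 2 ^ n * (estimate n k (sampleCount X φ) - hammingWeight X) := by
    rw [Finset.sum_sub_distrib, estimate, sampleCount]
    simp
    field_simp
  rw [he, abs_mul, abs_of_pos (by positivity)]
  calc (k : ℝ) * (1 / 200) = k / 2 ^ n * (1 / 200 * 2 ^ n) := by field_simp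
    _ < _ := by gcongr

/-- Rounding an accurate estimate gives a correct solution on promised inputs. -/
theorem roundedEstimate_correct {n k c w s : ℕ} (hw : w ≤ 2 ^ n) (hs : s < 2 ^ n)
    (hws : |(w : ℝ) - s| ≤ 9 / 100 * 2 ^ n) (he : |estimate n k c - w| ≤ 1 / 200 * 2 ^ n) :
    |(w : ℝ) - ((roundedEstimate n k c : ℕ) : ℝ)| ≤ 2 ^ n / 10 := by
  have hN1 : 1 ≤ 2 ^ n := Nat.one_le_two_pow
  have he0 : 0 ≤ estimate n k c := by unfold estimate; positivity
  obtain ⟨h1, h2⟩ := abs_le.mp he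
  have hf1 := Nat.floor_le (show 0 ≤ estimate n k c + 1 / 2 by positivity)
  have hf2 := Nat.lt_floor_add_one (estimate n k c + 1 / 2)
  simp only [roundedEstimate]
  set r := ⌊estimate n k c + 1 / 2⌋₊
  have hNc : ((2 ^ n : ℕ) : ℝ) = 2 ^ n := by push_cast; rfl
  rw [← hNc] at hws h1 h2 ⊢
  clear he hNc
  generalize 2 ^ n = N at *
  by_cases hN : 10 ≤ N
  · have hN' : (10 : ℝ) ≤ N := by exact_mod_cast hN
    have hw' : (w : ℝ) ≤ N := by exact_mod_cast hw
    have hcast : ((N - 1 : ℕ) : ℝ) = N - 1 := by push_cast [hN1]; ring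
    rw [Nat.cast_min, hcast, abs_le]
    constructor
    · have := min_le_left (r : ℝ) (N - 1)
      linarith
    · have : (w : ℝ) - N / 10 ≤ min (r : ℝ) (N - 1) := le_min (by linarith) (by linarith)
      linarith
  · have hN' : (N : ℝ) ≤ 9 := by exact_mod_cast (by omega : N ≤ 9)
    have hws1 : w = s := by
      have h3 : |((w : ℤ) - s : ℤ)| < 1 := by
        have : |((w : ℝ) - s)| < 1 := by linarith
        exact_mod_cast this
      have := Int.abs_lt_one_iff.mp h3
      omega
    have hr : r = w := by
      have h3 : (r : ℝ) < w + 1 := by linarith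
      have h4 : (w : ℝ) < r + 1 := by linarith
      have h5 : r < w + 1 := by exact_mod_cast h3
      have h6 : w < r + 1 := by exact_mod_cast h4
      omega
    have : min r (N - 1) = w := by omega
    rw [this]
    simp only [sub_self, abs_zero]
    positivity

theorem guessOrEstimate_correct {n k c w s : ℕ} (t : Fin (2 ^ n)) (hw : w ≤ 2 ^ n)
    (hs : s < 2 ^ n) (hws : |(w : ℝ) - s| ≤ 9 / 100 * 2 ^ n)
    (he : |estimate n k c - w| ≤ 1 / 200 * 2 ^ n) :
    |(w : ℝ) - ((guessOrEstimate n k t c : ℕ) : ℝ)| ≤ 2 ^ n / 10 := by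
  unfold guessOrEstimate
  split_ifs with h
  · rw [abs_le] at *
    constructor <;> linarith
  · exact roundedEstimate_correct hw hs hws he

theorem guessOrEstimate_eq {n k c w : ℕ} (t : Fin (2 ^ n))
    (hws : |(w : ℝ) - (t : ℕ)| ≤ 9 / 100 * 2 ^ n)
    (he : |estimate n k c - w| ≤ 1 / 200 * 2 ^ n) : guessOrEstimate n k t c = t := by
  unfold guessOrEstimate
  rw [if_pos]
  rw [abs_le] at *
  constructor <;> linarith

theorem samplingAlg_prob_rel {n k : ℕ} {I : OracleInput n}
    (hI : I ∈ (quantumLockedEstimation n).domain) :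
    1 - ((badSamples k I.X).card : ℝ) / (2 ^ n) ^ k ≤
      (samplingAlg n k).prob I {y | (quantumLockedEstimation n).rel I y} := by
  classical
  obtain ⟨s, -, hs⟩ := hI
  rw [samplingAlg, prob_uniform_map, le_div_iff₀ (by simp)]
  have hsub : (Finset.univ \ badSamples k I.X) ×ˢ (Finset.univ : Finset (Fin (2 ^ n))) ⊆
      Finset.univ.filter fun ω : (Fin k → Fin (2 ^ n)) × Fin (2 ^ n) =>
        (countTree (guessOrEstimate n k ω.2) (List.ofFn ω.1) 0).run I ∈
          {y | (quantumLockedEstimation n).rel I y} := by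
    rintro ⟨φ, t⟩ h
    simp only [badSamples, Finset.mem_product, Finset.mem_sdiff, Finset.mem_filter,
      Finset.mem_univ, true_and, not_lt, and_true, Set.mem_ofPred_eq] at h ⊢
    rw [countTree_ofFn_run]
    exact guessOrEstimate_correct t (hammingWeight_le _) s.isLt hs h
  have hc := Finset.card_le_card hsub
  rw [Finset.card_product, Finset.card_univ_sdiff] at hc
  have hb : (badSamples k I.X).card ≤ (2 ^ n) ^ k := by
    simpa using Finset.card_le_univ (badSamples k I.X)
  simp only [Fintype.card_fun, Fintype.card_fin, Finset.card_univ] at hc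
  refine le_trans (le_of_eq ?_) (Nat.cast_le.mpr hc)
  push_cast [hb]
  simp
  field_simp

theorem samplingAlg_prob_not_rel {n k : ℕ} {I : OracleInput n}
    (hI : I ∈ (quantumLockedEstimation n).domain) :
    (samplingAlg n k).prob I {y | ¬ (quantumLockedEstimation n).rel I y} ≤
      ((badSamples k I.X).card : ℝ) / (2 ^ n) ^ k := by
  classical
  obtain ⟨s, -, hs⟩ := hI
  rw [samplingAlg, prob_uniform_map, div_le_iff₀ (by simp)]
  have hsub : (Finset.univ.filter fun ω : (Fin k → Fin (2 ^ n)) × Fin (2 ^ n) =>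
        (countTree (guessOrEstimate n k ω.2) (List.ofFn ω.1) 0).run I ∈
          {y | ¬ (quantumLockedEstimation n).rel I y}) ⊆
      badSamples k I.X ×ˢ (Finset.univ : Finset (Fin (2 ^ n))) := by
    rintro ⟨φ, t⟩ h
    simp only [badSamples, Finset.mem_product, Finset.mem_filter,
      Finset.mem_univ, true_and, and_true, Set.mem_ofPred_eq] at h ⊢
    rw [countTree_ofFn_run] at h
    by_contra h'
    exact h (guessOrEstimate_correct t (hammingWeight_le _) s.isLt hs (not_lt.mp h'))
  have hc := Finset.card_le_card hsub
  rw [Finset.card_product] at hc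
  refine le_trans (Nat.cast_le.mpr hc) (le_of_eq ?_)
  simp
  field_simp

theorem samplingAlg_prob_singleton {n k : ℕ} {I : OracleInput n} (t : Fin (2 ^ n))
    (ht : |(hammingWeight I.X : ℝ) - (t : ℕ)| ≤ 9 / 100 * 2 ^ n) :
    (1 - ((badSamples k I.X).card : ℝ) / (2 ^ n) ^ k) / 2 ^ n ≤
      (samplingAlg n k).prob I {t} := by
  classical
  rw [samplingAlg, prob_uniform_map, le_div_iff₀ (by simp)]
  have hsub : (Finset.univ \ badSamples k I.X) ×ˢ {t} ⊆
      Finset.univ.filter fun ω : (Fin k → Fin (2 ^ n)) × Fin (2 ^ n) =>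
        (countTree (guessOrEstimate n k ω.2) (List.ofFn ω.1) 0).run I ∈ ({t} : Set _) := by
    rintro ⟨φ, t'⟩ h
    simp only [badSamples, Finset.mem_product, Finset.mem_sdiff, Finset.mem_filter,
      Finset.mem_univ, true_and, not_lt, Set.mem_singleton_iff, Finset.mem_singleton] at h ⊢
    rw [countTree_ofFn_run, h.2]
    exact guessOrEstimate_eq t ht h.1
  have hc := Finset.card_le_card hsub
  rw [Finset.card_product, Finset.card_univ_sdiff] at hc
  have hb : (badSamples k I.X).card ≤ (2 ^ n) ^ k := by
    simpa using Finset.card_le_univ (badSamples k I.X)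
  simp only [Fintype.card_fun, Fintype.card_fin, Finset.card_singleton, mul_one] at hc
  refine le_trans (le_of_eq ?_) (Nat.cast_le.mpr hc)
  push_cast [hb]
  simp
  field_simp

/-- On the promised inputs of length parameter `1` no sample is bad. -/
theorem badSamples_zero {I : OracleInput 0} (hI : I ∈ (quantumLockedEstimation 0).domain) :
    badSamples 0 I.X = ∅ := by
  classical
  obtain ⟨s, -, hs⟩ := hI
  have hs0 : s.toNat = 0 := by have := s.isLt; omega
  have hw : hammingWeight I.X = 0 := by
    rw [hs0] at hs
    have h1 : (hammingWeight I.X : ℝ) < 1 := by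
      have := (abs_le.mp hs).2
      norm_num at this
      linarith
    have h2 : hammingWeight I.X < 1 := by exact_mod_cast h1
    omega
  refine Finset.filter_eq_empty_iff.mpr fun φ _ => ?_
  simp [estimate, hw]

theorem two_mul_exp_neg_le (n : ℕ) : 2 * Real.exp (-(4 * (n : ℝ))) ≤ 2 / 16 ^ n := by
  have h1 : Real.exp (-(4 * (n : ℝ))) = 1 / (Real.exp 1 ^ 4) ^ n := by
    rw [Real.exp_neg, ← Real.exp_nat_mul, ← Real.exp_nat_mul, one_div]
    congr 2
    push_cast; ring
  have h2 : (16 : ℝ) ≤ Real.exp 1 ^ 4 := by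
    have : (2 : ℝ) ≤ Real.exp 1 := by linarith [Real.add_one_le_exp (1 : ℝ)]
    calc (16 : ℝ) = 2 ^ 4 := by norm_num
      _ ≤ _ := by gcongr
  rw [h1, ← mul_div_assoc, mul_one]
  gcongr

theorem badSamples_fraction_le {n : ℕ} (m : ℕ) (hm : 0 < m) (X : Fin (2 ^ n) → Bool) :
    ((badSamples (640000 * m) X).card : ℝ) / (2 ^ n) ^ (640000 * m) ≤ 2 / 16 ^ m := by
  have h := card_badSamples_le (k := 640000 * m) (by omega) X
  rw [div_le_iff₀ (by positivity), mul_comm (2 / 16 ^ m : ℝ)]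
  refine h.trans ?_
  gcongr
  refine le_trans (le_of_eq ?_) (two_mul_exp_neg_le m)
  congr 3
  push_cast; ring

/-- The failure probability of the sampling algorithm with a linear number of samples. -/
theorem badSamples_linear_fraction_le {n : ℕ} {I : OracleInput n}
    (hI : I ∈ (quantumLockedEstimation n).domain) :
    ((badSamples (640000 * n) I.X).card : ℝ) / (2 ^ n) ^ (640000 * n) ≤ 1 / (4 * 2 ^ n) := by
  rcases Nat.eq_zero_or_pos n with rfl | hn
  · rw [badSamples_zero hI]; simp
  · refine (badSamples_fraction_le n hn I.X).trans ?_
    rw [div_le_div_iff₀ (by positivity) (by positivity)]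
    have h : (8 : ℝ) ^ 1 ≤ 8 ^ n := pow_le_pow_right₀ (by norm_num) hn
    have h16 : (16 : ℝ) ^ n = 2 ^ n * 8 ^ n := by rw [← mul_pow]; norm_num
    rw [h16]
    have : (0 : ℝ) < 2 ^ n := by positivity
    nlinarith

theorem samplingAlg_solves_const (n : ℕ) :
    (quantumLockedEstimation n).Solves (samplingAlg n 640000).prob := by
  intro I hI
  have h := badSamples_fraction_le 1 one_pos I.X
  have h2 := samplingAlg_prob_rel (k := 640000) hI
  rw [mul_one] at h
  rw [pow_one] at h
  linarith

theorem samplingAlg_solves_linear (n : ℕ) :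
    (quantumLockedEstimation n).Solves (samplingAlg n (640000 * n)).prob := by
  intro I hI
  have h := badSamples_linear_fraction_le hI
  have h2 := samplingAlg_prob_rel (k := 640000 * n) hI
  have h3 : 1 / (4 * 2 ^ n) ≤ (1 / 4 : ℝ) := by
    apply one_div_le_one_div_of_le (by norm_num)
    linarith [one_le_pow₀ (one_le_two : (1 : ℝ) ≤ 2) (n := n)]
  linarith

/-- The secret of a promised input. -/
def secret {n : ℕ} (I : (quantumLockedEstimation n).domain) : BitVec n := I.2.choose

theorem isSimon_secret {n : ℕ} (I : (quantumLockedEstimation n).domain) :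
    IsSimon I.1.f (secret I) := I.2.choose_spec.1

theorem hammingWeight_sub_secret {n : ℕ} (I : (quantumLockedEstimation n).domain) :
    |(hammingWeight I.1.X : ℝ) - ((secret I).toNat : ℝ)| ≤ 9 / 100 * (2 : ℝ) ^ n :=
  I.2.choose_spec.2

theorem rel_secret {n : ℕ} (I : (quantumLockedEstimation n).domain) :
    (quantumLockedEstimation n).rel I (secret I).toFin := by
  have h := hammingWeight_sub_secret I
  have hN : (0 : ℝ) < 2 ^ n := by positivity
  change |(hammingWeight I.1.X : ℝ) - ((secret I).toNat : ℝ)| ≤ _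
  linarith

theorem secret_funCanonizes_samplingAlg (n : ℕ) :
    (quantumLockedEstimation n).FunCanonizes (fun I => (secret I).toFin)
      (samplingAlg n (640000 * n)) := by
  intro I
  have h := badSamples_linear_fraction_le I.2
  have h1 := samplingAlg_prob_not_rel (k := 640000 * n) I.2
  have h2 := samplingAlg_prob_singleton (k := 640000 * n) (I := I.1) (secret I).toFin
    (hammingWeight_sub_secret I)
  have h3 : (1 : ℝ) ≤ 2 ^ n := one_le_pow₀ one_le_two
  refine lt_of_le_of_lt (h1.trans h) (lt_of_lt_of_le ?_ h2)
  have h4 : 1 / (4 * 2 ^ n) ≤ (1 / 4 : ℝ) :=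
    one_div_le_one_div_of_le (by norm_num) (by linarith)
  rw [← div_div]
  gcongr
  linarith

end

noncomputable section

/-! ### Characters of `{0,1}^n` -/

/-- The character `(-1)^(z · x)`. -/
def chi {n : ℕ} (z x : BitVec n) : ℝ :=
  ∏ i : Fin n, if (z.getLsbD i && x.getLsbD i) then -1 else 1

theorem chi_comm {n : ℕ} (z x : BitVec n) : chi z x = chi x z := by
  simp only [chi, Bool.and_comm]

theorem chi_xor_right {n : ℕ} (z x y : BitVec n) : chi z (x ^^^ y) = chi z x * chi z y := by
  simp only [chi, ← Finset.prod_mul_distrib]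
  refine Finset.prod_congr rfl fun i _ => ?_
  rw [BitVec.getLsbD_xor]
  cases z.getLsbD i <;> cases x.getLsbD i <;> cases y.getLsbD i <;> simp

theorem chi_xor_left {n : ℕ} (x y z : BitVec n) : chi (x ^^^ y) z = chi x z * chi y z := by
  simp only [chi_comm _ z, chi_xor_right]

theorem chi_zero_right {n : ℕ} (z : BitVec n) : chi z 0#n = 1 := by simp [chi]

theorem chi_mul_self {n : ℕ} (z x : BitVec n) : chi z x * chi z x = 1 := by
  rw [← chi_xor_right, BitVec.xor_self, chi_zero_right]

theorem chi_eq_one_or {n : ℕ} (z x : BitVec n) : chi z x = 1 ∨ chi z x = -1 :=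
  mul_self_eq_one_iff.mp (chi_mul_self z x)

theorem exists_chi_eq_neg_one {n : ℕ} {x : BitVec n} (hx : x ≠ 0#n) : ∃ e, chi e x = -1 := by
  obtain ⟨i, hi, hxi⟩ : ∃ i, i < n ∧ x.getLsbD i = true := by
    by_contra! h
    exact hx (BitVec.eq_of_getLsbD_eq fun i hi => by simpa using h i hi)
  refine ⟨BitVec.twoPow n i, ?_⟩
  rw [chi, Finset.prod_eq_single ⟨i, hi⟩]
  · simp [hi, hxi]
  · intro j _ hj
    have : i ≠ j := fun h => hj (Fin.ext h.symm)
    rw [BitVec.getLsbD_twoPow, decide_eq_false this]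
    simp
  · simp

theorem card_bitVec (n : ℕ) : Fintype.card (BitVec n) = 2 ^ n := by
  rw [Fintype.card_congr (BitVec.equivFin (m := n)).toEquiv, Fintype.card_fin]

theorem sum_chi {n : ℕ} (x : BitVec n) : ∑ z, chi z x = if x = 0#n then (2 : ℝ) ^ n else 0 := by
  split_ifs with h
  · subst h
    simp [chi_zero_right, card_bitVec]
  · obtain ⟨e, he⟩ := exists_chi_eq_neg_one h
    have h1 : ∑ z, chi (z ^^^ e) x = ∑ z, chi z x :=
      Function.Bijective.sum_comp (Function.Involutive.bijective fun z => by
        rw [BitVec.xor_assoc, BitVec.xor_self, BitVec.xor_zero]) fun z => chi z x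
    simp only [chi_xor_left, he, mul_neg, mul_one, Finset.sum_neg_distrib] at h1
    linarith

/-! ### Gates -/

/-- The Hadamard transform on `n` qubits. -/
def hadamard (n : ℕ) : Matrix (BitVec n) (BitVec n) ℂ :=
  Matrix.of fun z x => ((chi z x / √(2 ^ n) : ℝ) : ℂ)

theorem hadamard_mem_unitaryGroup (n : ℕ) :
    hadamard n ∈ Matrix.unitaryGroup (BitVec n) ℂ := by
  rw [Matrix.mem_unitaryGroup_iff]
  ext x y
  have hs : √(2 ^ n : ℝ) * √(2 ^ n) = 2 ^ n := Real.mul_self_sqrt (by positivity)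
  simp only [Matrix.mul_apply, Matrix.star_apply, hadamard, Matrix.of_apply, Complex.star_def,
    Complex.conj_ofReal, Matrix.one_apply]
  rw [← Complex.ofReal_one, ← Complex.ofReal_zero, ← apply_ite Complex.ofReal]
  simp only [← Complex.ofReal_mul]
  rw [← Complex.ofReal_sum]
  congr 1
  have : ∀ z, chi x z / √(2 ^ n) * (chi y z / √(2 ^ n)) = chi z (x ^^^ y) / 2 ^ n := by
    intro z
    rw [div_mul_div_comm, hs, chi_comm z, chi_xor_left]
  simp only [this, ← Finset.sum_div, sum_chi, BitVec.xor_eq_zero_iff]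
  split_ifs <;> simp

open scoped Kronecker in
/-- The Hadamard transform on the address register of the oracle for `f`. -/
def hadamardGate (n : ℕ) (W : Type) [Fintype W] [DecidableEq W] : QGate n W :=
  .unitary ⟨(hadamard n ⊗ₖ (1 : Matrix (BitVec n) (BitVec n) ℂ)) ⊗ₖ
      (1 : Matrix ((Fin (2 ^ n) × Bool) × W) ((Fin (2 ^ n) × Bool) × W) ℂ),
    Matrix.kronecker_mem_unitary
      (Matrix.kronecker_mem_unitary (hadamard_mem_unitaryGroup n) (one_mem _)) (one_mem _)⟩

theorem hadamardGate_mulVec {n : ℕ} {W : Type} [Fintype W] [DecidableEq W] (I : OracleInput n)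
    (ψ : QBasis n W → ℂ) (x y : BitVec n) (r : (Fin (2 ^ n) × Bool) × W) :
    ((hadamardGate n W).toMatrix I).mulVec ψ ((x, y), r) =
      ∑ x', hadamard n x x' * ψ ((x', y), r) := by
  simp only [hadamardGate, QGate.toMatrix, Matrix.mulVec, dotProduct]
  rw [Fintype.sum_prod_type, Fintype.sum_prod_type]
  refine Finset.sum_congr rfl fun x' _ => ?_
  rw [Finset.sum_eq_single y, Finset.sum_eq_single r]
  · simp [Matrix.kroneckerMap_apply]
  · intro r' _ h
    simp [Matrix.kroneckerMap_apply, Matrix.one_apply_ne h.symm]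
  · simp
  · intro y' _ h
    simp [Matrix.kroneckerMap_apply, Matrix.one_apply_ne h.symm]
  · simp

theorem involution_mulVec {β : Type*} [Fintype β] [DecidableEq β] {o : β → β}
    (ho : Function.Involutive o) (ψ : β → ℂ) :
    (Matrix.of fun b' b => if b' = o b then (1 : ℂ) else 0).mulVec ψ = ψ ∘ o := by
  ext b'
  simp only [Matrix.mulVec, dotProduct, Matrix.of_apply, Function.comp]
  rw [Finset.sum_eq_single (o b')]
  · simp [ho b']
  · intro b _ hb
    rw [if_neg, zero_mul]
    rintro rfl
    exact hb (ho b).symm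
  · simp

theorem involution_mem_unitaryGroup {β : Type*} [Fintype β] [DecidableEq β] {o : β → β}
    (ho : Function.Involutive o) :
    (Matrix.of fun b' b => if b' = o b then (1 : ℂ) else 0) ∈ Matrix.unitaryGroup β ℂ := by
  rw [Matrix.mem_unitaryGroup_iff']
  ext b' b
  simp only [Matrix.mul_apply, Matrix.star_apply, Matrix.of_apply, Matrix.one_apply]
  rw [Finset.sum_eq_single (o b)]
  · simp [ho.injective.eq_iff, eq_comm]
  · intro c _ hc
    rw [if_neg hc, mul_zero]
  · simp

/-- The workspace of Simon's algorithm: one slot for each sample. -/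
abbrev SimonSpace (n m : ℕ) : Type := Fin m → BitVec n × BitVec n

/-- Exchange the registers of the oracle for `f` with the slot `j` of the workspace. -/
def swapSlot {n m : ℕ} (j : Fin m) (b : QBasis n (SimonSpace n m)) : QBasis n (SimonSpace n m) :=
  (b.2.2 j, b.2.1, Function.update b.2.2 j b.1)

theorem swapSlot_involutive {n m : ℕ} (j : Fin m) :
    Function.Involutive (swapSlot (n := n) j) := by
  rintro ⟨p, r, w⟩
  simp [swapSlot]

/-- The gate that stores the registers of the oracle for `f` in the slot `j`. -/
def swapGate {n m : ℕ} (j : Fin m) : QGate n (SimonSpace n m) :=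
  .unitary ⟨_, involution_mem_unitaryGroup (swapSlot_involutive j)⟩

theorem oracleF_involutive {n : ℕ} {W : Type} (I : OracleInput n) :
    Function.Involutive (oracleF (W := W) I) := by
  rintro ⟨⟨x, y⟩, ⟨i, b⟩, w⟩
  simp [oracleF]

/-! ### Simon's algorithm -/

/-- The initial state of the registers of the oracle for `X`, which the algorithm does not use. -/
def idleAddress (n : ℕ) : Fin (2 ^ n) × Bool := (⟨0, Nat.two_pow_pos n⟩, false)

/-- A product state of the registers of the oracle for `f` and the slots of the workspace. -/
def productState {n m : ℕ} (a : BitVec n × BitVec n → ℂ) (g : Fin m → BitVec n × BitVec n → ℂ) :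
    QBasis n (SimonSpace n m) → ℂ :=
  fun b => a b.1 * (if b.2.1 = idleAddress n then 1 else 0) * ∏ l, g l (b.2.2 l)

theorem hadamardGate_productState {n m : ℕ} (I : OracleInput n) (a : BitVec n × BitVec n → ℂ)
    (g : Fin m → BitVec n × BitVec n → ℂ) :
    ((hadamardGate n (SimonSpace n m)).toMatrix I).mulVec (productState a g) =
      productState (fun p => ∑ x, hadamard n p.1 x * a (x, p.2)) g := by
  ext ⟨⟨x, y⟩, r⟩
  rw [hadamardGate_mulVec]
  simp only [productState, Finset.sum_mul, mul_assoc]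

theorem queryF_productState {n m : ℕ} (I : OracleInput n) (a : BitVec n × BitVec n → ℂ)
    (g : Fin m → BitVec n × BitVec n → ℂ) :
    ((QGate.queryF : QGate n (SimonSpace n m)).toMatrix I).mulVec (productState a g) =
      productState (fun p => a (p.1, p.2 ^^^ I.f p.1)) g := by
  rw [QGate.toMatrix, involution_mulVec (oracleF_involutive I)]
  rfl

theorem swapGate_productState {n m : ℕ} (I : OracleInput n) (j : Fin m)
    (a : BitVec n × BitVec n → ℂ) (g : Fin m → BitVec n × BitVec n → ℂ) :
    ((swapGate j).toMatrix I).mulVec (productState a g) =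
      productState (g j) (Function.update g j a) := by
  rw [swapGate, QGate.toMatrix, involution_mulVec (swapSlot_involutive j)]
  ext ⟨p, r, w⟩
  simp only [productState, swapSlot, Function.comp]
  rw [← Finset.mul_prod_erase Finset.univ (fun l => g l _) (Finset.mem_univ j),
    ← Finset.mul_prod_erase Finset.univ (fun l => Function.update g j a l _) (Finset.mem_univ j)]
  have : ∏ l ∈ Finset.univ.erase j, g l (Function.update w j p l) =
      ∏ l ∈ Finset.univ.erase j, Function.update g j a l (w l) := by
    refine Finset.prod_congr rfl fun l hl => ?_
    have hl' := Finset.ne_of_mem_erase hl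
    rw [Function.update_of_ne hl', Function.update_of_ne hl']
  rw [this, Function.update_self, Function.update_self]
  by_cases hr : r = idleAddress n
  · simp only [hr, if_true, mul_one]
    ring
  · simp [hr]

/-- The amplitudes of the registers before they are cleared. -/
def zeroState (n : ℕ) : BitVec n × BitVec n → ℂ := Pi.single (0#n, 0#n) 1

/-- The amplitudes `2^(-n) ∑_{f x = y} (-1)^(z · x)` of one sample of Simon's algorithm. -/
def simonAmplitude {n : ℕ} (f : BitVec n → BitVec n) (p : BitVec n × BitVec n) : ℝ :=
  (∑ x, if f x = p.2 then chi p.1 x else 0) / 2 ^ n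

/-- One round of Simon's algorithm. -/
def simonRound {n m : ℕ} (j : Fin m) : List (QGate n (SimonSpace n m)) :=
  [hadamardGate n _, .queryF, hadamardGate n _, swapGate j]

theorem simonRound_foldl {n m : ℕ} (I : OracleInput n) (j : Fin m)
    (g : Fin m → BitVec n × BitVec n → ℂ) (hg : g j = zeroState n) :
    (simonRound j).foldl (fun ψ G => (G.toMatrix I).mulVec ψ) (productState (zeroState n) g) =
      productState (zeroState n)
        (Function.update g j fun p => (simonAmplitude I.f p : ℂ)) := by
  simp only [simonRound, List.foldl_cons, List.foldl_nil, hadamardGate_productState,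
    queryF_productState, swapGate_productState, hg]
  congr 2
  ext ⟨z, y⟩
  have hs : √(2 ^ n : ℝ) * √(2 ^ n) = 2 ^ n := Real.mul_self_sqrt (by positivity)
  have h1 : ∀ x, ∑ x', hadamard n x x' * zeroState n (x', y ^^^ I.f x) =
      if I.f x = y then (((1 / √(2 ^ n) : ℝ)) : ℂ) else 0 := by
    intro x
    rw [Finset.sum_eq_single 0#n]
    · by_cases h : I.f x = y
      · simp [h, zeroState, hadamard, chi_zero_right]
      · have h' : y ^^^ I.f x ≠ 0#n := by
          rw [Ne, BitVec.xor_eq_zero_iff]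
          exact fun e => h e.symm
        simp [h, zeroState, h']
    · intro x' _ hx'
      simp [zeroState, hx']
    · simp
  simp only [h1]
  simp only [simonAmplitude, hadamard, Matrix.of_apply]
  rw [Finset.sum_div]
  push_cast
  refine Finset.sum_congr rfl fun x _ => ?_
  split_ifs
  · rw [← Complex.ofReal_one, ← Complex.ofReal_div, ← Complex.ofReal_div, ← Complex.ofReal_mul,
      div_mul_div_comm, hs]
    push_cast
    simp
  · simp

theorem simonRounds_foldl {n m : ℕ} (I : OracleInput n) (L : List (Fin m)) (hL : L.Nodup)
    (g : Fin m → BitVec n × BitVec n → ℂ) (hg : ∀ j ∈ L, g j = zeroState n) :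
    (L.flatMap simonRound).foldl (fun ψ G => (G.toMatrix I).mulVec ψ)
        (productState (zeroState n) g) =
      productState (zeroState n)
        (fun l => if l ∈ L then fun p => (simonAmplitude I.f p : ℂ) else g l) := by
  induction L generalizing g with
  | nil => simp
  | cons j L ih =>
    rw [List.nodup_cons] at hL
    rw [List.flatMap_cons, List.foldl_append, simonRound_foldl I j g (hg j (by simp)),
      ih hL.2]
    · congr 1
      ext l : 1
      by_cases h : l ∈ L
      · simp [h]
      · by_cases h' : l = j
        · subst h'; simp [h]
        · simp [h, h']
    · intro l hl
      have : l ≠ j := fun e => hL.1 (e ▸ hl)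
      rw [Function.update_of_ne this]
      exact hg l (by simp [hl])

open Classical in
/-- A nonzero string orthogonal to all samples if there is one, and zero otherwise. -/
def orthogonalString {n m : ℕ} (w : SimonSpace n m) : BitVec n :=
  if h : ∃ u : BitVec n, u ≠ 0#n ∧ ∀ l, chi u (w l).1 = 1 then h.choose else 0#n

/-- Simon's algorithm with `m` samples. -/
def simonAlg (n m : ℕ) : QuantumAlg n (Fin (2 ^ n)) where
  W := SimonSpace n m
  start := ((0#n, 0#n), idleAddress n, fun _ => (0#n, 0#n))
  circuit := (List.finRange m).flatMap simonRound
  out b := (orthogonalString b.2.2).toFin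

theorem simonAlg_queries (n m : ℕ) : (simonAlg n m).queries = m := by
  have : ∀ L : List (Fin m),
      ((L.flatMap (simonRound (n := n))).map QGate.cost).sum = L.length := by
    intro L
    induction L with
    | nil => simp
    | cons j L ih =>
      rw [List.flatMap_cons, List.map_append, List.sum_append, ih]
      simp [simonRound, QGate.cost, hadamardGate, swapGate, add_comm]
  exact (this _).trans (by simp)

theorem simonAlg_finalState (n m : ℕ) (I : OracleInput n) :
    (simonAlg n m).finalState I =
      productState (zeroState n) fun _ p => (simonAmplitude I.f p : ℂ) := by
  have h0 : (Pi.single (simonAlg n m).start 1 : QBasis n (SimonSpace n m) → ℂ) =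
      productState (zeroState n) fun _ => zeroState n := by
    ext ⟨p, r, w⟩
    simp only [productState, zeroState, simonAlg, Pi.single_apply, Prod.mk.injEq]
    by_cases hp : p = (0#n, 0#n)
    · by_cases hr : r = idleAddress n
      · by_cases hw : w = fun _ => (0#n, 0#n)
        · subst hp hr hw; simp
        · obtain ⟨l, hl⟩ := Function.ne_iff.mp hw
          simp only [hw, and_false, if_false]
          rw [Finset.prod_eq_zero (Finset.mem_univ l) (if_neg hl), mul_zero]
      · simp [hr]
    · simp [hp]
  have h := simonRounds_foldl I (List.finRange m) (List.nodup_finRange m)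
    (fun _ => zeroState n) (fun _ _ => rfl)
  simp only [List.mem_finRange, if_true] at h
  rw [← h, ← h0]
  rfl

/-- The probability that Simon's algorithm measures the samples `w`. -/
def sampleProb {n m : ℕ} (f : BitVec n → BitVec n) (w : SimonSpace n m) : ℝ :=
  ∏ l, simonAmplitude f (w l) ^ 2

open Classical in
/-- The measured samples of Simon's algorithm are independent. -/
theorem simonAlg_prob (n m : ℕ) (I : OracleInput n) (S : Set (Fin (2 ^ n))) :
    (simonAlg n m).prob I S = ∑ w : SimonSpace n m,
      if (orthogonalString w).toFin ∈ S then sampleProb I.f w else 0 := by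
  rw [QuantumAlg.prob, simonAlg_finalState]
  change ∑ b : QBasis n (SimonSpace n m), (if (orthogonalString b.2.2).toFin ∈ S then _ else _) = _
  rw [Fintype.sum_prod_type, Finset.sum_eq_single (0#n, 0#n)]
  · rw [Fintype.sum_prod_type, Finset.sum_eq_single (idleAddress n)]
    · refine Finset.sum_congr rfl fun w _ => ?_
      simp [productState, zeroState, sampleProb, Finset.prod_pow, ← Finset.abs_prod]
    · intro r _ hr
      simp [productState, hr]
    · simp
  · intro p _ hp
    simp [productState, zeroState, hp]
  · simp

/-! ### The distribution of one sample -/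

theorem sum_chi_mul_simonAmplitude_sq {n : ℕ} (f : BitVec n → BitVec n) (u : BitVec n) :
    ∑ p, chi u p.1 * simonAmplitude f p ^ 2 =
      ((Finset.univ.filter fun x => f x = f (x ^^^ u)).card : ℝ) / 2 ^ n := by
  have h1 : ∀ z y, chi u z * simonAmplitude f (z, y) ^ 2 =
      (∑ x, ∑ x', if f x = y then (if f x' = y then chi z (u ^^^ x ^^^ x') else 0) else 0)
        / (2 ^ n * 2 ^ n) := by
    intro z y
    rw [simonAmplitude, div_pow, sq, sq, Finset.sum_mul_sum, mul_div_assoc', Finset.mul_sum]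
    congr 1
    refine Finset.sum_congr rfl fun x _ => ?_
    rw [Finset.mul_sum]
    refine Finset.sum_congr rfl fun x' _ => ?_
    rw [chi_xor_right, chi_xor_right, chi_comm u]
    split_ifs <;> ring
  rw [Fintype.sum_prod_type, Finset.sum_comm]
  simp only [h1, ← Finset.sum_div]
  rw [div_eq_div_iff (by positivity) (by positivity), ← mul_assoc]
  congr 1
  have h2 : ∀ y, ∑ z : BitVec n, ∑ x, ∑ x',
      (if f x = y then (if f x' = y then chi z (u ^^^ x ^^^ x') else 0) else 0) =
      ∑ x, if f x = y ∧ f (x ^^^ u) = y then (2 : ℝ) ^ n else 0 := by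
    intro y
    rw [Finset.sum_comm]
    refine Finset.sum_congr rfl fun x _ => ?_
    rw [Finset.sum_comm]
    have h3 : ∀ x', (∑ z : BitVec n,
        if f x = y then (if f x' = y then chi z (u ^^^ x ^^^ x') else 0) else 0) =
        if x' = x ^^^ u then (if f x = y ∧ f x' = y then (2 : ℝ) ^ n else 0) else 0 := by
      intro x'
      have h4 : (u ^^^ x ^^^ x' = 0#n) ↔ x' = x ^^^ u := by
        rw [BitVec.xor_eq_zero_iff, BitVec.xor_comm u, eq_comm]
      by_cases h5 : f x = y <;> by_cases h6 : f x' = y <;> simp [h5, h6, sum_chi, h4]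
    simp only [h3]
    simp
  simp only [h2]
  rw [Finset.sum_comm]
  have h7 : ∀ x, ∑ y, (if f x = y ∧ f (x ^^^ u) = y then (2 : ℝ) ^ n else 0) =
      if f x = f (x ^^^ u) then 2 ^ n else 0 := by
    intro x
    rw [Finset.sum_eq_single (f x)]
    · simp [eq_comm]
    · intro y _ hy
      rw [if_neg]
      exact fun h => hy h.1.symm
    · simp
  simp only [h7]
  rw [← Finset.sum_filter, Finset.sum_const, nsmul_eq_mul]

theorem sum_simonAmplitude_sq {n : ℕ} (f : BitVec n → BitVec n) :
    ∑ p, simonAmplitude f p ^ 2 = 1 := by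
  have h := sum_chi_mul_simonAmplitude_sq f 0#n
  simp only [BitVec.xor_zero, chi_comm 0#n, chi_zero_right, one_mul] at h
  rw [h]
  simp [card_bitVec]

open Classical in
theorem sum_orthogonal_simonAmplitude_sq {n : ℕ} {f : BitVec n → BitVec n} {s u : BitVec n}
    (hf : IsSimon f s) (hu : u ≠ 0#n) (hus : u ≠ s) :
    (∑ p, if chi u p.1 = 1 then simonAmplitude f p ^ 2 else 0) = 1 / 2 := by
  have h := sum_chi_mul_simonAmplitude_sq f u
  have h0 : (Finset.univ.filter fun x => f x = f (x ^^^ u)) = ∅ := by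
    refine Finset.filter_eq_empty_iff.mpr fun x _ hx => ?_
    rcases (hf _ _).mp hx with h1 | h1
    · apply hu
      have h2 : x ^^^ 0#n = x ^^^ u := by rw [BitVec.xor_zero]; exact h1
      exact ((BitVec.xor_right_inj x).mp h2).symm
    · rw [BitVec.xor_assoc] at h1
      have h2 : x ^^^ 0#n = x ^^^ (u ^^^ s) := by rw [BitVec.xor_zero]; exact h1
      exact hus (BitVec.xor_eq_zero_iff.mp ((BitVec.xor_right_inj x).mp h2).symm)
  rw [h0] at h
  have h1 : ∀ p : BitVec n × BitVec n, (if chi u p.1 = 1 then simonAmplitude f p ^ 2 else 0) =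
      (simonAmplitude f p ^ 2 + chi u p.1 * simonAmplitude f p ^ 2) / 2 := by
    intro p
    rcases chi_eq_one_or u p.1 with h | h
    · rw [h]; simp
    · rw [h]; norm_num
  simp only [h1]
  rw [← Finset.sum_div, Finset.sum_add_distrib, h, sum_simonAmplitude_sq]
  simp

theorem simonAmplitude_eq_zero {n : ℕ} {f : BitVec n → BitVec n} {s : BitVec n}
    (hf : IsSimon f s) {p : BitVec n × BitVec n} (hp : chi s p.1 ≠ 1) :
    simonAmplitude f p = 0 := by
  have h := sum_chi_mul_simonAmplitude_sq f s
  have h0 : (Finset.univ.filter fun x => f x = f (x ^^^ s)) = Finset.univ := by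
    refine Finset.filter_true_of_mem fun x _ => ?_
    rw [hf]
    right
    rw [BitVec.xor_assoc, BitVec.xor_self, BitVec.xor_zero]
  rw [h0, Finset.card_univ, card_bitVec] at h
  have h1 : ∑ p, (1 - chi s p.1) * simonAmplitude f p ^ 2 = 0 := by
    simp only [sub_mul, one_mul, Finset.sum_sub_distrib]
    rw [h, sum_simonAmplitude_sq]
    simp
  have h2 : ∀ p : BitVec n × BitVec n, 0 ≤ (1 - chi s p.1) * simonAmplitude f p ^ 2 := by
    intro p
    refine mul_nonneg ?_ (sq_nonneg _)
    rcases chi_eq_one_or s p.1 with h | h <;> rw [h] <;> norm_num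
  have h3 := (Finset.sum_eq_zero_iff_of_nonneg fun p _ => h2 p).mp h1 p (Finset.mem_univ p)
  have h4 : 1 - chi s p.1 ≠ 0 := fun e => hp (by linarith)
  simpa [h4] using h3

/-! ### Correctness -/

/-- Samples that are orthogonal to no unwanted string determine the secret. -/
theorem orthogonalString_eq {n m : ℕ} {w : SimonSpace n m} {s : BitVec n}
    (hs : ∀ l, chi s (w l).1 = 1)
    (hw : ∀ u, u ≠ 0#n → u ≠ s → ¬ ∀ l, chi u (w l).1 = 1) : orthogonalString w = s := by
  unfold orthogonalString
  split_ifs with h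
  · by_contra hne
    exact hw _ h.choose_spec.1 hne h.choose_spec.2
  · by_contra hne
    exact h ⟨s, fun e => hne e.symm, hs⟩

theorem simonAlg_prob_secret {n m : ℕ} {I : OracleInput n} {s : BitVec n} (hI : IsSimon I.f s) :
    1 - (2 ^ n - 1) * (1 / 2) ^ m ≤ (simonAlg n m).prob I {s.toFin} := by
  classical
  rw [simonAlg_prob]
  have hP0 : ∀ w : SimonSpace n m, 0 ≤ sampleProb I.f w := fun w => Finset.prod_nonneg fun l _ => sq_nonneg _
  have hP1 : ∑ w : SimonSpace n m, sampleProb I.f w = 1 := by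
    simp only [sampleProb]
    rw [← Fintype.prod_sum fun (_ : Fin m) p => simonAmplitude I.f p ^ 2]
    simp [sum_simonAmplitude_sq]
  have hPu : ∀ u, u ≠ 0#n → u ≠ s →
      (∑ w : SimonSpace n m, if ∀ l, chi u (w l).1 = 1 then sampleProb I.f w else 0) = (1 / 2) ^ m := by
    intro u hu hus
    have h1 : ∀ w : SimonSpace n m, (if ∀ l, chi u (w l).1 = 1 then sampleProb I.f w else 0) =
        ∏ l, if chi u (w l).1 = 1 then simonAmplitude I.f (w l) ^ 2 else 0 := by
      intro w
      split_ifs with h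
      · exact Finset.prod_congr rfl fun l _ => by rw [if_pos (h l)]
      · push Not at h
        obtain ⟨l, hl⟩ := h
        exact (Finset.prod_eq_zero (Finset.mem_univ l) (if_neg hl)).symm
    simp only [h1]
    rw [← Fintype.prod_sum fun (_ : Fin m) p =>
      if chi u p.1 = 1 then simonAmplitude I.f p ^ 2 else 0]
    simp [sum_orthogonal_simonAmplitude_sq hI hu hus]
  set U : Finset (BitVec n) := Finset.univ.filter fun u => u ≠ 0#n ∧ u ≠ s with hU
  have hUc : (U.card : ℝ) ≤ 2 ^ n - 1 := by
    have h1 : U ⊆ Finset.univ.erase 0#n := fun u hu => by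
      rw [hU, Finset.mem_filter] at hu
      exact Finset.mem_erase.mpr ⟨hu.2.1, Finset.mem_univ u⟩
    have h2 := Finset.card_le_card h1
    rw [Finset.card_erase_of_mem (Finset.mem_univ _), Finset.card_univ, card_bitVec] at h2
    have h3 : (U.card : ℝ) ≤ ((2 ^ n - 1 : ℕ) : ℝ) := by exact_mod_cast h2
    rwa [Nat.cast_sub Nat.one_le_two_pow, Nat.cast_pow, Nat.cast_one, Nat.cast_ofNat] at h3
  have hmain : ∀ w : SimonSpace n m, sampleProb I.f w ≤ (if (orthogonalString w).toFin ∈ ({s.toFin} : Set _) then sampleProb I.f w else 0) +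
      ∑ u ∈ U, if ∀ l, chi u (w l).1 = 1 then sampleProb I.f w else 0 := by
    intro w
    have hnn : 0 ≤ ∑ u ∈ U, if ∀ l, chi u (w l).1 = 1 then sampleProb I.f w else 0 :=
      Finset.sum_nonneg fun u _ => by split_ifs <;> simp [hP0]
    by_cases hs : ∀ l, chi s (w l).1 = 1
    · by_cases hw : ∀ u, u ≠ 0#n → u ≠ s → ¬ ∀ l, chi u (w l).1 = 1
      · rw [orthogonalString_eq hs hw, if_pos (Set.mem_singleton _)]
        linarith
      · push Not at hw
        obtain ⟨u, hu0, hus, hu⟩ := hw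
        have h1 : sampleProb I.f w ≤ ∑ u ∈ U, if ∀ l, chi u (w l).1 = 1 then sampleProb I.f w else 0 := by
          refine le_trans (le_of_eq ?_) (Finset.single_le_sum
            (f := fun u => if ∀ l, chi u (w l).1 = 1 then sampleProb I.f w else 0)
            (fun u _ => by split_ifs <;> simp [hP0])
            (show u ∈ U by simp [hU, hu0, hus]))
          rw [if_pos hu]
        have h2 : 0 ≤ if (orthogonalString w).toFin ∈ ({s.toFin} : Set _) then sampleProb I.f w else 0 := by
          split_ifs <;> simp [hP0]
        linarith
    · push Not at hs
      obtain ⟨l, hl⟩ := hs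
      have h0 : sampleProb I.f w = 0 := by
        refine Finset.prod_eq_zero (Finset.mem_univ l) ?_
        rw [simonAmplitude_eq_zero hI hl]
        simp
      simp [h0]
  have h := Finset.sum_le_sum fun w (_ : w ∈ Finset.univ) => hmain w
  rw [hP1, Finset.sum_add_distrib, Finset.sum_comm] at h
  have h2 : ∑ u ∈ U, ∑ w : SimonSpace n m, (if ∀ l, chi u (w l).1 = 1 then sampleProb I.f w else 0) = U.card * (1 / 2) ^ m := by
    rw [← nsmul_eq_mul, ← Finset.sum_const]
    refine Finset.sum_congr rfl fun u hu => ?_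
    rw [hU, Finset.mem_filter] at hu
    exact hPu u hu.2.1 hu.2.2
  rw [h2] at h
  have h3 : (U.card : ℝ) * (1 / 2) ^ m ≤ (2 ^ n - 1) * (1 / 2) ^ m := by gcongr
  have h4 := (sub_le_sub_left h3 1).trans (sub_le_iff_le_add.mpr h)
  exact h4.trans (le_of_eq (Finset.sum_congr rfl fun w _ => by congr))

theorem simonAlg_psSolvesWith (n : ℕ) :
    (quantumLockedEstimation n).PsSolvesWith (simonAlg n (3 * n)).prob
      fun I => (secret I).toFin := by
  intro I
  refine ⟨rel_secret I, le_trans ?_ (simonAlg_prob_secret (isSimon_secret I))⟩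
  have h8 : ((1 : ℝ) / 2) ^ (3 * n) = 1 / (2 ^ n * 2 ^ n * 2 ^ n) := by
    rw [div_pow, one_pow, mul_comm, pow_mul]
    ring
  have h1 : (1 : ℝ) ≤ 2 ^ n := one_le_pow₀ one_le_two
  rw [h8]
  have h2 : ((2 : ℝ) ^ n - 1) * (1 / (2 ^ n * 2 ^ n * 2 ^ n)) ≤ 1 / 3 := by
    rw [mul_one_div, div_le_div_iff₀ (by positivity) (by norm_num)]
    generalize (2 : ℝ) ^ n = N at *
    nlinarith [sq_nonneg (N - 2), mul_nonneg (sub_nonneg.mpr h1) (sq_nonneg (N - 1)),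
      mul_nonneg (sub_nonneg.mpr h1) (sub_nonneg.mpr h1), sq_nonneg (N - 3 / 2)]
  linarith

end

noncomputable section

/-! ### Queried positions -/

/-- The addresses at which a decision tree queries `f` on input `I`. -/
def DTree.queriedF {n : ℕ} {Y : Type} (I : OracleInput n) : DTree n Y → Finset (BitVec n)
  | .output _ => ∅
  | .queryF x next => insert x ((next (I.f x)).queriedF I)
  | .queryX i next => (next (I.X i)).queriedF I

/-- The positions at which a decision tree queries `X` on input `I`. -/
def DTree.queriedX {n : ℕ} {Y : Type} (I : OracleInput n) : DTree n Y → Finset (Fin (2 ^ n))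
  | .output _ => ∅
  | .queryF x next => (next (I.f x)).queriedX I
  | .queryX i next => insert i ((next (I.X i)).queriedX I)

theorem DTree.card_queriedF_le {n : ℕ} {Y : Type} (I : OracleInput n) (T : DTree n Y) :
    (T.queriedF I).card ≤ T.depth := by
  induction T with
  | output y => simp [DTree.queriedF]
  | queryF x next ih =>
    have h := Finset.le_sup (f := fun v => (next v).depth) (Finset.mem_univ (I.f x))
    have h2 := Finset.card_insert_le x ((next (I.f x)).queriedF I)
    have h3 := ih (I.f x)
    simp only [DTree.queriedF, DTree.depth] at h ⊢
    omega
  | queryX i next ih =>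
    have h := Finset.le_sup (f := fun v => (next v).depth) (Finset.mem_univ (I.X i))
    have h3 := ih (I.X i)
    simp only [DTree.queriedF, DTree.depth] at h ⊢
    omega

theorem DTree.card_queriedX_le {n : ℕ} {Y : Type} (I : OracleInput n) (T : DTree n Y) :
    (T.queriedX I).card ≤ T.depth := by
  induction T with
  | output y => simp [DTree.queriedX]
  | queryF x next ih =>
    have h := Finset.le_sup (f := fun v => (next v).depth) (Finset.mem_univ (I.f x))
    have h3 := ih (I.f x)
    simp only [DTree.queriedX, DTree.depth] at h ⊢
    omega
  | queryX i next ih =>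
    have h := Finset.le_sup (f := fun v => (next v).depth) (Finset.mem_univ (I.X i))
    have h2 := Finset.card_insert_le i ((next (I.X i)).queriedX I)
    have h3 := ih (I.X i)
    simp only [DTree.queriedX, DTree.depth] at h ⊢
    omega

/-- A run depends only on the answers to the queries made. -/
theorem DTree.run_congr {n : ℕ} {Y : Type} {I J : OracleInput n} (T : DTree n Y)
    (hF : ∀ x ∈ T.queriedF I, J.f x = I.f x) (hX : ∀ i ∈ T.queriedX I, J.X i = I.X i) :
    T.run J = T.run I ∧ T.queriedF J = T.queriedF I := by
  induction T with
  | output y => simp [DTree.run, DTree.queriedF]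
  | queryF x next ih =>
    simp only [DTree.queriedF, DTree.queriedX, Finset.mem_insert, forall_eq_or_imp] at hF hX
    have h := ih (I.f x) hF.2 hX
    simp only [DTree.run, DTree.queriedF, hF.1, h, and_self]
  | queryX i next ih =>
    simp only [DTree.queriedF, DTree.queriedX, Finset.mem_insert, forall_eq_or_imp] at hF hX
    have h := ih (I.X i) hF hX.2
    simp only [DTree.run, DTree.queriedF, hX.1, h, and_self]

/-! ### Counting bounds for randomized algorithms -/

/-- The probability that a randomized algorithm picks a decision tree in `S`. -/
def RandAlg.mass {n : ℕ} {Y : Type} (A : RandAlg n Y) (S : Set (DTree n Y)) : ℝ :=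
  (A.toOuterMeasure S).toReal

theorem PMF.sum_toOuterMeasure {Y κ : Type*} (A : PMF Y) (K : Finset κ)
    (S : κ → Set Y) [∀ T, DecidablePred fun k => T ∈ S k] :
    ∑ k ∈ K, A.toOuterMeasure (S k) = ∑' T, A T * ((K.filter fun k => T ∈ S k).card : ℝ≥0∞) := by
  simp only [PMF.toOuterMeasure_apply]
  rw [← Summable.tsum_finsetSum fun _ _ => ENNReal.summable]
  refine tsum_congr fun T => ?_
  rw [Finset.card_filter, Nat.cast_sum, Finset.mul_sum]
  refine Finset.sum_congr rfl fun k _ => ?_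
  by_cases h : T ∈ S k <;> simp [h]

theorem PMF.toOuterMeasure_ne_top {Y : Type*} (A : PMF Y) (S : Set Y) :
    A.toOuterMeasure S ≠ ⊤ := by
  rw [PMF.toOuterMeasure_apply]
  refine ne_top_of_le_ne_top (b := 1) ENNReal.one_ne_top ?_
  rw [← A.tsum_coe]
  exact ENNReal.tsum_le_tsum fun T => Set.indicator_le_self' (by simp) T

/-- A counting inequality that holds for every decision tree of `A` holds on average. -/
theorem RandAlg.sum_mass_le {n : ℕ} {Y : Type} {κ ι : Type*} (A : RandAlg n Y) (K : Finset κ)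
    (L : Finset ι) (S : κ → Set (DTree n Y)) (B : ι → Set (DTree n Y)) (c : ℕ)
    [∀ T, DecidablePred fun k => T ∈ S k] [∀ T, DecidablePred fun l => T ∈ B l]
    (h : ∀ T ∈ A.support,
      (K.filter fun k => T ∈ S k).card ≤ (L.filter fun l => T ∈ B l).card + c) :
    ∑ k ∈ K, A.mass (S k) ≤ ∑ l ∈ L, A.mass (B l) + c := by
  have hE : ∑ k ∈ K, A.toOuterMeasure (S k) ≤ ∑ l ∈ L, A.toOuterMeasure (B l) + c := by
    have hc : (c : ℝ≥0∞) = ∑' T, A T * c := by rw [ENNReal.tsum_mul_right, A.tsum_coe, one_mul]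
    rw [PMF.sum_toOuterMeasure, PMF.sum_toOuterMeasure, hc,
      ← ENNReal.tsum_add]
    refine ENNReal.tsum_le_tsum fun T => ?_
    by_cases hT : T ∈ A.support
    · rw [← mul_add]
      gcongr
      exact_mod_cast h T hT
    · rw [PMF.mem_support_iff, not_not] at hT
      simp [hT]
  have hfin : ∑ l ∈ L, A.toOuterMeasure (B l) ≠ ⊤ :=
    ENNReal.sum_ne_top.mpr fun l _ => PMF.toOuterMeasure_ne_top A _
  have h2 := ENNReal.toReal_mono (ENNReal.add_ne_top.mpr ⟨hfin, ENNReal.natCast_ne_top c⟩) hE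
  rw [ENNReal.toReal_add hfin (ENNReal.natCast_ne_top c),
    ENNReal.toReal_sum fun k _ => PMF.toOuterMeasure_ne_top A _,
    ENNReal.toReal_sum fun k _ => PMF.toOuterMeasure_ne_top A _,
    ENNReal.toReal_natCast] at h2
  exact h2

/-- The probability that `A` queries `X` at position `i` on input `I`. -/
def RandAlg.queryProb {n : ℕ} {Y : Type} (A : RandAlg n Y) (I : OracleInput n)
    (i : Fin (2 ^ n)) : ℝ :=
  A.mass {T | i ∈ T.queriedX I}

theorem RandAlg.sum_queryProb_le {n : ℕ} {Y : Type} {A : RandAlg n Y} {q : ℕ}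
    (hA : A.QueriesAtMost q) (I : OracleInput n) (B : Finset (Fin (2 ^ n))) :
    ∑ i ∈ B, A.queryProb I i ≤ q := by
  classical
  have h := A.sum_mass_le B (∅ : Finset (Fin (2 ^ n))) (fun i => {T | i ∈ T.queriedX I})
    (fun _ => ∅) q fun T hT => by
      refine le_trans (Finset.card_le_card (t := T.queriedX I)
        fun i hi => (Finset.mem_filter.mp hi).2) ?_
      exact ((T.card_queriedX_le I).trans (hA T hT)).trans (Nat.le_add_left _ _)
  rw [Finset.sum_empty, zero_add] at h
  exact h

/-- The input string with the positions in `B` flipped. -/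
def flipBits {n : ℕ} (X : Fin (2 ^ n) → Bool) (B : Finset (Fin (2 ^ n))) : Fin (2 ^ n) → Bool :=
  fun i => if i ∈ B then !X i else X i

theorem flipBits_flipBits_singleton {n : ℕ} (X : Fin (2 ^ n) → Bool) {B : Finset (Fin (2 ^ n))}
    {i : Fin (2 ^ n)} (hi : i ∈ B) : flipBits (flipBits X B) {i} = flipBits X (B.erase i) := by
  ext j
  by_cases hj : j = i
  · subst hj; simp [flipBits, hi]
  · simp [flipBits, hj]

/-- If flipping the block `B` changes the likely output, then `B` is likely to be queried. -/
theorem third_le_sum_queryProb {n : ℕ} {Y : Type} {A : RandAlg n Y} {f : BitVec n → BitVec n}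
    {X : Fin (2 ^ n) → Bool} {B : Finset (Fin (2 ^ n))} {y y' : Y} (hne : y ≠ y')
    (hy : 2 / 3 ≤ A.prob ⟨f, X⟩ {y}) (hy' : 2 / 3 ≤ A.prob ⟨f, flipBits X B⟩ {y'}) :
    1 / 3 ≤ ∑ i ∈ B, A.queryProb ⟨f, X⟩ i := by
  classical
  have h := A.sum_mass_le (Finset.univ : Finset Bool) B
    (fun b => bif b then {T | T.run ⟨f, X⟩ ∈ ({y} : Set Y)}
      else {T | T.run ⟨f, flipBits X B⟩ ∈ ({y'} : Set Y)})
    (fun i => {T | i ∈ T.queriedX ⟨f, X⟩}) 1 fun T _ => by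
      by_cases hB : ∃ i ∈ B, i ∈ T.queriedX ⟨f, X⟩
      · obtain ⟨i, hi, hiT⟩ := hB
        refine (Finset.card_filter_le _ _).trans (le_trans ?_ (Nat.add_le_add_right
          (Finset.card_pos.mpr ⟨i, Finset.mem_filter.mpr ⟨hi, hiT⟩⟩) 1))
        rw [Finset.card_univ, Fintype.card_bool]
      · push Not at hB
        have hrun := (T.run_congr (I := ⟨f, X⟩) (J := ⟨f, flipBits X B⟩) (fun _ _ => rfl)
          fun i hi => by
            have : i ∉ B := fun h => hB i h hi
            simp [flipBits, this]).1
        refine le_trans (Finset.card_le_one.mpr ?_) (Nat.le_add_left _ _)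
        rintro (_ | _) ha (_ | _) hb <;>
          simp only [Finset.mem_filter, Finset.mem_univ, true_and, cond_true, cond_false,
            Set.mem_ofPred_eq, Set.mem_singleton_iff] at ha hb ⊢
        · exact absurd (hb.symm.trans (hrun.symm.trans ha)) hne
        · exact absurd (ha.symm.trans (hrun.symm.trans hb)) hne
  rw [Fintype.sum_bool] at h
  simp only [cond_true, cond_false, Nat.cast_one] at h
  change A.prob ⟨f, X⟩ {y} + A.prob ⟨f, flipBits X B⟩ {y'} ≤ ∑ i ∈ B, A.queryProb ⟨f, X⟩ i + 1 at h
  linarith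

/-- The canonical output does not change when positions are flipped that are unlikely to be
queried. -/
theorem canonical_flipBits_eq {n : ℕ} {Y : Type} {A : RandAlg n Y} {q : ℕ}
    (hA : A.QueriesAtMost q) (g : OracleInput n → Y) {f : BitVec n → BitVec n}
    {X : Fin (2 ^ n) → Bool} {D : Finset (Fin (2 ^ n))}
    (hg : ∀ B ⊆ D, 2 / 3 ≤ A.prob ⟨f, flipBits X B⟩ {g ⟨f, flipBits X B⟩})
    (hD : ∀ i ∈ D, 9 * q * A.queryProb ⟨f, X⟩ i < 1) :
    g ⟨f, flipBits X D⟩ = g ⟨f, X⟩ := by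
  classical
  by_contra hne
  have hX : flipBits X ∅ = X := by ext i; simp [flipBits]
  have hgX := hg ∅ (Finset.empty_subset _)
  rw [hX] at hgX
  obtain ⟨B, hB, hmin⟩ := Finset.exists_min_image
    (D.powerset.filter fun B => g ⟨f, flipBits X B⟩ ≠ g ⟨f, X⟩) Finset.card
    ⟨D, by simp [hne]⟩
  rw [Finset.mem_filter, Finset.mem_powerset] at hB
  obtain ⟨hBD, hBne⟩ := hB
  have hB0 : B.Nonempty := by
    rw [Finset.nonempty_iff_ne_empty]
    rintro rfl
    exact hBne (by rw [hX])
  have hsens : ∀ i ∈ B, 1 / 3 ≤ A.queryProb ⟨f, flipBits X B⟩ i := by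
    intro i hi
    have h1 : g ⟨f, flipBits X (B.erase i)⟩ = g ⟨f, X⟩ := by
      by_contra h
      have h2 := hmin (B.erase i) (by
        rw [Finset.mem_filter, Finset.mem_powerset]
        exact ⟨(Finset.erase_subset _ _).trans hBD, h⟩)
      have h3 := Finset.card_erase_lt_of_mem hi
      omega
    have h2 := third_le_sum_queryProb (B := {i}) (A := A) (f := f) (X := flipBits X B)
      (y' := g ⟨f, X⟩) hBne (hg B hBD) (by
        rw [flipBits_flipBits_singleton X hi]
        have := hg (B.erase i) ((Finset.erase_subset _ _).trans hBD)
        rwa [h1] at this)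
    simpa using h2
  have hcard : (B.card : ℝ) ≤ 3 * q := by
    have h1 := A.sum_queryProb_le hA ⟨f, flipBits X B⟩ B
    have h2 := Finset.sum_le_sum hsens
    rw [Finset.sum_const, nsmul_eq_mul] at h2
    linarith
  have hq : 1 / 3 ≤ ∑ i ∈ B, A.queryProb ⟨f, X⟩ i :=
    third_le_sum_queryProb hBne.symm hgX (hg B hBD)
  have hlt : ∑ i ∈ B, 9 * q * A.queryProb ⟨f, X⟩ i < ∑ i ∈ B, (1 : ℝ) :=
    Finset.sum_lt_sum_of_nonempty hB0 fun i hi => hD i (hBD hi)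
  rw [← Finset.mul_sum, Finset.sum_const, nsmul_eq_mul, mul_one] at hlt
  have : 9 * (q : ℝ) * (1 / 3) ≤ 9 * q * ∑ i ∈ B, A.queryProb ⟨f, X⟩ i := by gcongr
  linarith

/-- Few positions are likely to be queried. -/
theorem card_likely_queried_le {n : ℕ} {Y : Type} {A : RandAlg n Y} {q : ℕ}
    (hA : A.QueriesAtMost q) (I : OracleInput n) :
    (Finset.univ.filter fun i => 1 ≤ 9 * q * A.queryProb I i).card ≤ 9 * q ^ 2 := by
  set Q := Finset.univ.filter fun i => 1 ≤ 9 * q * A.queryProb I i with hQ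
  have h1 : ∑ i ∈ Q, (1 : ℝ) ≤ ∑ i ∈ Q, 9 * q * A.queryProb I i :=
    Finset.sum_le_sum fun i hi => (Finset.mem_filter.mp hi).2
  rw [← Finset.mul_sum, Finset.sum_const, nsmul_eq_mul, mul_one] at h1
  have h2 := A.sum_queryProb_le hA I Q
  have h3 : 9 * (q : ℝ) * ∑ i ∈ Q, A.queryProb I i ≤ 9 * q * q := by gcongr
  have h4 : (Q.card : ℝ) ≤ ((9 * q ^ 2 : ℕ) : ℝ) := by
    push_cast
    nlinarith
  exact_mod_cast h4

/-! ### Random Simon functions -/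

/-- The representative of the class `{x, x ⊕ s}`. -/
def xorRep {n : ℕ} (s x : BitVec n) : BitVec n := if x.toNat ≤ (x ^^^ s).toNat then x else x ^^^ s

theorem xor_xor_cancel {n : ℕ} (x s : BitVec n) : x ^^^ s ^^^ s = x := by
  rw [BitVec.xor_assoc, BitVec.xor_self, BitVec.xor_zero]

theorem xorRep_eq_or {n : ℕ} (s x : BitVec n) : xorRep s x = x ∨ xorRep s x = x ^^^ s := by
  unfold xorRep
  split_ifs <;> simp

theorem xorRep_xor {n : ℕ} (s x : BitVec n) : xorRep s (x ^^^ s) = xorRep s x := by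
  unfold xorRep
  rw [xor_xor_cancel]
  split_ifs with h1 h2 h2
  · exact BitVec.eq_of_toNat_eq (le_antisymm h1 h2)
  · rfl
  · rfl
  · omega

theorem xorRep_xorRep {n : ℕ} (s x : BitVec n) : xorRep s (xorRep s x) = xorRep s x := by
  rcases xorRep_eq_or s x with h | h
  · rw [h, h]
  · conv_lhs => rw [h]
    exact xorRep_xor s x

theorem xorRep_eq_iff {n : ℕ} (s x y : BitVec n) :
    xorRep s x = xorRep s y ↔ x = y ∨ x = y ^^^ s := by
  constructor
  · intro h
    rcases xorRep_eq_or s x with hx | hx <;> rcases xorRep_eq_or s y with hy | hy <;>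
      rw [hx, hy] at h
    · exact Or.inl h
    · exact Or.inr h
    · right; rw [← h, xor_xor_cancel]
    · left; exact (BitVec.xor_left_inj s).mp h
  · rintro (rfl | rfl)
    · rfl
    · exact xorRep_xor s y

/-- The Simon function with secret `s` obtained from a permutation. -/
def simonFun {n : ℕ} (σ : Equiv.Perm (BitVec n)) (s x : BitVec n) : BitVec n := σ (xorRep s x)

theorem isSimon_simonFun {n : ℕ} (σ : Equiv.Perm (BitVec n)) (s : BitVec n) :
    IsSimon (simonFun σ s) s := fun x y => by
  rw [simonFun, simonFun, σ.injective.eq_iff, xorRep_eq_iff]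

/-- Exchange the members of the classes `{x, x ⊕ s}` that meet `Q` but whose representative is not
in `Q`. -/
def repSwap {n : ℕ} (Q : Finset (BitVec n)) (s x : BitVec n) : BitVec n :=
  if (x ∈ Q ∨ x ^^^ s ∈ Q) ∧ xorRep s x ∉ Q then x ^^^ s else x

theorem repSwap_involutive {n : ℕ} (Q : Finset (BitVec n)) (s : BitVec n) :
    Function.Involutive (repSwap Q s) := by
  intro x
  by_cases h : (x ∈ Q ∨ x ^^^ s ∈ Q) ∧ xorRep s x ∉ Q
  · have h1 : repSwap Q s x = x ^^^ s := if_pos h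
    rw [h1, repSwap, if_pos, xor_xor_cancel]
    rw [xor_xor_cancel, xorRep_xor, or_comm]
    exact h
  · have h1 : repSwap Q s x = x := if_neg h
    rw [h1, h1]

theorem repSwap_xorRep {n : ℕ} {Q : Finset (BitVec n)} {s x : BitVec n} (hx : x ∈ Q)
    (hxs : x ^^^ s ∉ Q) : repSwap Q s (xorRep s x) = x := by
  unfold repSwap
  rw [xorRep_xorRep]
  rcases xorRep_eq_or s x with h | h
  · simp [h, hx]
  · simp [h, hx, hxs]

open Classical in
/-- A decision tree with few queries hardly distinguishes a random permutation from a Simon function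
with random secret. -/
theorem DTree.card_run_perm_le {n q : ℕ} {Y : Type} (T : DTree n Y) (hT : T.depth ≤ q)
    (X : Fin (2 ^ n) → Bool) (E : Set Y) (S : Finset (BitVec n)) :
    ((S ×ˢ (Finset.univ : Finset (Equiv.Perm (BitVec n)))).filter
        fun k => T.run ⟨k.2, X⟩ ∈ E).card ≤
      ((S ×ˢ (Finset.univ : Finset (Equiv.Perm (BitVec n)))).filter
        fun k => T.run ⟨simonFun k.2 k.1, X⟩ ∈ E).card +
        q ^ 2 * Fintype.card (Equiv.Perm (BitVec n)) := by
  set K := S ×ˢ (Finset.univ : Finset (Equiv.Perm (BitVec n))) with hK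
  set Q : Equiv.Perm (BitVec n) → Finset (BitVec n) := fun σ => T.queriedF ⟨σ, X⟩ with hQ
  set G := K.filter fun k => T.run ⟨k.2, X⟩ ∈ E ∧ ∀ x ∈ Q k.2, x ^^^ k.1 ∉ Q k.2 with hG
  set C := K.filter fun k => ∃ x ∈ Q k.2, x ^^^ k.1 ∈ Q k.2 with hC
  have hsub : (K.filter fun k => T.run ⟨k.2, X⟩ ∈ E) ⊆ G ∪ C := by
    intro k hk
    rw [Finset.mem_filter] at hk
    rw [Finset.mem_union, hG, hC, Finset.mem_filter, Finset.mem_filter]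
    by_cases h : ∃ x ∈ Q k.2, x ^^^ k.1 ∈ Q k.2
    · exact Or.inr ⟨hk.1, h⟩
    · push Not at h
      exact Or.inl ⟨hk.1, hk.2, h⟩
  have hCcard : C.card ≤ q ^ 2 * Fintype.card (Equiv.Perm (BitVec n)) := by
    have h1 : C ⊆ Finset.univ.biUnion fun σ : Equiv.Perm (BitVec n) =>
        ((Q σ ×ˢ Q σ).image fun p => p.1 ^^^ p.2) ×ˢ {σ} := by
      rintro ⟨s, σ⟩ hk
      rw [hC, Finset.mem_filter] at hk
      obtain ⟨-, x, hx, hxs⟩ := hk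
      rw [Finset.mem_biUnion]
      refine ⟨σ, Finset.mem_univ _, ?_⟩
      rw [Finset.mem_product, Finset.mem_image]
      refine ⟨⟨(x, x ^^^ s), Finset.mem_product.mpr ⟨hx, hxs⟩, ?_⟩, by simp⟩
      simp only
      rw [← BitVec.xor_assoc, BitVec.xor_self, BitVec.zero_xor]
    refine (Finset.card_le_card h1).trans (Finset.card_biUnion_le.trans ?_)
    rw [mul_comm, ← smul_eq_mul, ← Finset.card_univ, ← Finset.sum_const]
    refine Finset.sum_le_sum fun σ _ => ?_
    rw [Finset.card_product, Finset.card_singleton, mul_one]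
    refine Finset.card_image_le.trans ?_
    rw [Finset.card_product, sq]
    have h2 := (T.card_queriedF_le ⟨σ, X⟩).trans hT
    exact Nat.mul_le_mul h2 h2
  have hkey : ∀ k ∈ G, T.run ⟨simonFun ((repSwap_involutive (Q k.2) k.1).toPerm.trans k.2) k.1, X⟩ =
        T.run ⟨k.2, X⟩ ∧
      T.queriedF ⟨simonFun ((repSwap_involutive (Q k.2) k.1).toPerm.trans k.2) k.1, X⟩ =
        Q k.2 := by
    intro k hk
    rw [hG, Finset.mem_filter] at hk
    refine T.run_congr (I := ⟨k.2, X⟩) (fun x hx => ?_) fun _ _ => rfl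
    simp only [simonFun, Equiv.trans_apply, Function.Involutive.coe_toPerm]
    rw [repSwap_xorRep hx (hk.2.2 x hx)]
  have hGcard : G.card ≤ (K.filter fun k => T.run ⟨simonFun k.2 k.1, X⟩ ∈ E).card := by
    refine Finset.card_le_card_of_injOn
      (fun k => (k.1, (repSwap_involutive (Q k.2) k.1).toPerm.trans k.2)) ?_ ?_
    · intro k hk
      have h1 := (hkey k hk).1
      have h2 := Finset.mem_filter.mp (Finset.mem_coe.mp hk)
      rw [Finset.mem_coe, Finset.mem_filter]
      simp only
      rw [h1]
      refine ⟨?_, h2.2.1⟩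
      have h3 := (Finset.mem_product.mp h2.1).1
      exact Finset.mem_product.mpr ⟨h3, Finset.mem_univ _⟩
    · rintro ⟨s, σ⟩ hk ⟨s', σ'⟩ hk' heq
      simp only [Prod.mk.injEq] at heq
      obtain ⟨rfl, heq⟩ := heq
      have h1 := (hkey _ hk).2
      have h2 := (hkey _ hk').2
      simp only at h1 h2
      rw [heq, h2] at h1
      rw [h1] at heq
      have h3 : σ = σ' := by
        ext1 x
        have h4 := congrArg (fun e : Equiv.Perm (BitVec n) => e (repSwap (Q σ) s x)) heq
        simpa [repSwap_involutive (Q σ) s x] using h4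
      rw [h3]
  calc _ ≤ (G ∪ C).card := Finset.card_le_card hsub
    _ ≤ G.card + C.card := Finset.card_union_le _ _
    _ ≤ _ := Nat.add_le_add hGcard hCcard

/-- A randomized algorithm that outputs a value in `E` with probability at most `1/3` on all Simon
functions with a secret in `S` rarely does so on a random permutation. -/
theorem sum_prob_perm_le {n q : ℕ} {Y : Type} {A : RandAlg n Y} (hA : A.QueriesAtMost q)
    (X : Fin (2 ^ n) → Bool) (E : Set Y) (S : Finset (BitVec n))
    (h : ∀ s ∈ S, ∀ σ, A.prob ⟨simonFun σ s, X⟩ E ≤ 1 / 3) :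
    (S.card : ℝ) * ∑ σ : Equiv.Perm (BitVec n), A.prob ⟨σ, X⟩ E ≤
      (S.card / 3 + q ^ 2) * Fintype.card (Equiv.Perm (BitVec n)) := by
  classical
  have h1 := A.sum_mass_le (S ×ˢ (Finset.univ : Finset (Equiv.Perm (BitVec n))))
    (S ×ˢ (Finset.univ : Finset (Equiv.Perm (BitVec n))))
    (fun k => {T | T.run ⟨k.2, X⟩ ∈ E}) (fun k => {T | T.run ⟨simonFun k.2 k.1, X⟩ ∈ E})
    (q ^ 2 * Fintype.card (Equiv.Perm (BitVec n)))
    fun T hT => T.card_run_perm_le (hA T hT) X E S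
  rw [Finset.sum_product] at h1
  dsimp only at h1
  have h2 : ∑ k ∈ S ×ˢ (Finset.univ : Finset (Equiv.Perm (BitVec n))),
      A.mass {T | T.run ⟨simonFun k.2 k.1, X⟩ ∈ E} ≤
      ∑ k ∈ S ×ˢ (Finset.univ : Finset (Equiv.Perm (BitVec n))), (1 / 3 : ℝ) :=
    Finset.sum_le_sum fun k hk => h k.1 (Finset.mem_product.mp hk).1 k.2
  rw [Finset.sum_const, nsmul_eq_mul] at h1
  rw [Finset.sum_const, nsmul_eq_mul, Finset.card_product, Finset.card_univ] at h2
  push_cast at h1 h2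
  change (S.card : ℝ) * ∑ σ : Equiv.Perm (BitVec n), A.prob ⟨σ, X⟩ E ≤ _ at h1
  linarith

end

noncomputable section

/-! ### The classical lower bound -/

theorem RandAlg.prob_add_prob_le {n : ℕ} {Y : Type} (A : RandAlg n Y) (I : OracleInput n)
    {E F : Set Y} (h : Disjoint E F) : A.prob I E + A.prob I F ≤ 1 := by
  classical
  have h1 := A.sum_mass_le (Finset.univ : Finset Bool) (∅ : Finset Bool)
    (fun b => {T | T.run I ∈ bif b then E else F}) (fun _ => ∅) 1 fun T _ => by
      refine le_trans (Finset.card_le_one.mpr ?_) (Nat.le_add_left _ _)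
      rintro (_ | _) ha (_ | _) hb <;>
        simp only [Finset.mem_filter, Finset.mem_univ, true_and, cond_true, cond_false,
          Set.mem_ofPred_eq] at ha hb ⊢
      · exact (Set.disjoint_left.mp h hb ha).elim
      · exact (Set.disjoint_left.mp h ha hb).elim
  rw [Fintype.sum_bool, Finset.sum_empty, zero_add, Nat.cast_one] at h1
  exact h1

theorem RandAlg.one_le_prob_add_prob_compl {n : ℕ} {Y : Type} (A : RandAlg n Y)
    (I : OracleInput n) (E : Set Y) : 1 ≤ A.prob I E + A.prob I Eᶜ := by
  classical
  have huniv : A.mass Set.univ = 1 := by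
    rw [RandAlg.mass, PMF.toOuterMeasure_apply, Set.indicator_univ, A.tsum_coe, ENNReal.toReal_one]
  have h1 := A.sum_mass_le ({()} : Finset Unit) (Finset.univ : Finset Bool) (fun _ => Set.univ)
    (fun b => {T | T.run I ∈ bif b then E else Eᶜ}) 0 fun T _ => by
      refine (Finset.card_filter_le _ _).trans ?_
      rw [Finset.card_singleton, add_zero, Nat.one_le_iff_ne_zero, ← Nat.pos_iff_ne_zero,
        Finset.card_pos]
      by_cases h : T.run I ∈ E
      · exact ⟨true, by simpa using h⟩
      · exact ⟨false, by simpa using h⟩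
  rw [Fintype.sum_bool, Finset.sum_singleton, huniv, Nat.cast_zero, add_zero] at h1
  exact h1

theorem hammingWeight_flipBits_ones {n : ℕ} (X : Fin (2 ^ n) → Bool) {B : Finset (Fin (2 ^ n))}
    (hB : ∀ i ∈ B, X i = true) : hammingWeight (flipBits X B) + B.card = hammingWeight X := by
  classical
  have h1 : (Finset.univ.filter fun i => flipBits X B i = true) =
      (Finset.univ.filter fun i => X i = true) \ B := by
    ext i
    by_cases hi : i ∈ B <;> simp [flipBits, hi, hB]
  have h2 : B ⊆ Finset.univ.filter fun i => X i = true := fun i hi => by simp [hB i hi]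
  rw [hammingWeight, h1, hammingWeight, Finset.card_sdiff_add_card_eq_card h2]

theorem hammingWeight_flipBits_zeros {n : ℕ} (X : Fin (2 ^ n) → Bool) {B : Finset (Fin (2 ^ n))}
    (hB : ∀ i ∈ B, X i = false) : hammingWeight (flipBits X B) = hammingWeight X + B.card := by
  classical
  have h1 : (Finset.univ.filter fun i => flipBits X B i = true) =
      (Finset.univ.filter fun i => X i = true) ∪ B := by
    ext i
    by_cases hi : i ∈ B <;> simp [flipBits, hi, hB]
  rw [hammingWeight, h1, hammingWeight, Finset.card_union_of_disjoint]
  rw [Finset.disjoint_left]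
  intro i hi hiB
  simp [hB i hiB] at hi

/-- The strings that are binary representations of the numbers in `[a, b)`. -/
def secretWindow (n a b : ℕ) : Finset (BitVec n) := (Finset.Ico a b).image (BitVec.ofNat n)

theorem toNat_of_mem_secretWindow {n a b : ℕ} (hb : b ≤ 2 ^ n) {s : BitVec n}
    (hs : s ∈ secretWindow n a b) : a ≤ s.toNat ∧ s.toNat < b := by
  obtain ⟨j, hj, rfl⟩ := Finset.mem_image.mp hs
  rw [Finset.mem_Ico] at hj
  rw [BitVec.toNat_ofNat, Nat.mod_eq_of_lt (by omega)]
  exact hj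

theorem card_secretWindow {n a b : ℕ} (hb : b ≤ 2 ^ n) : (secretWindow n a b).card = b - a := by
  rw [secretWindow, Finset.card_image_of_injOn, Nat.card_Ico]
  intro i hi j hj hij
  rw [Finset.mem_coe, Finset.mem_Ico] at hi hj
  have h := congrArg BitVec.toNat hij
  rwa [BitVec.toNat_ofNat, BitVec.toNat_ofNat, Nat.mod_eq_of_lt (by omega),
    Nat.mod_eq_of_lt (by omega)] at h

/-- The string whose first half consists of ones and whose second half consists of zeros. -/
def halfOnes (n : ℕ) : Fin (2 ^ n) → Bool := fun i => decide (2 * (i : ℕ) < 2 ^ n)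

theorem card_halfOnes_eq_true (k : ℕ) :
    (Finset.univ.filter fun i => halfOnes (k + 6) i = true).card = 32 * 2 ^ k := by
  have hN : 2 ^ (k + 6) = 64 * 2 ^ k := by rw [pow_add]; ring
  have h1 : (Finset.univ.filter fun i => halfOnes (k + 6) i = true) =
      Finset.univ.filter fun i : Fin (2 ^ (k + 6)) => (i : ℕ) < 32 * 2 ^ k := by
    ext i
    simp only [halfOnes, Finset.mem_filter, Finset.mem_univ, true_and, decide_eq_true_eq]
    omega
  rw [h1, Fin.card_filter_val_lt]
  omega

theorem card_halfOnes_eq_false (k : ℕ) :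
    (Finset.univ.filter fun i => halfOnes (k + 6) i = false).card = 32 * 2 ^ k := by
  have hN : 2 ^ (k + 6) = 64 * 2 ^ k := by rw [pow_add]; ring
  have h1 := Finset.card_filter_add_card_filter_not (s := Finset.univ)
    fun i => halfOnes (k + 6) i = true
  rw [card_halfOnes_eq_true, Finset.card_univ, Fintype.card_fin] at h1
  simp only [Bool.not_eq_true] at h1
  omega

/-- Among the positions of a set of size `N / 2` there are `N / 8` positions that an algorithm with
`o(√N)` queries is unlikely to query. -/
theorem exists_unlikely_queried {k q : ℕ} {Y : Type} {A : RandAlg (k + 6) Y}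
    (hA : A.QueriesAtMost q) (hq : 6 * q ^ 2 < 2 ^ k) (I : OracleInput (k + 6))
    {Z : Finset (Fin (2 ^ (k + 6)))} (hZ : Z.card = 32 * 2 ^ k) :
    ∃ D ⊆ Z, D.card = 8 * 2 ^ k ∧ ∀ i ∈ D, 9 * q * A.queryProb I i < 1 := by
  set Q := Finset.univ.filter fun i => 1 ≤ 9 * q * A.queryProb I i with hQ
  have h1 : Q.card ≤ 9 * q ^ 2 := card_likely_queried_le hA I
  have h2 := Finset.le_card_sdiff Q Z
  obtain ⟨D, hD, hDc⟩ := Finset.exists_subset_card_eq (show 8 * 2 ^ k ≤ (Z \ Q).card by omega)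
  refine ⟨D, hD.trans Finset.sdiff_subset, hDc, fun i hi => ?_⟩
  have h3 := (Finset.mem_sdiff.mp (hD hi)).2
  simpa [hQ] using h3

/-- If the secret is below `N / 2`, then so is the canonical solution on `halfOnes`. -/
theorem canonical_lt_half {k q : ℕ} {A : RandAlg (k + 6) (Fin (2 ^ (k + 6)))}
    (hA : A.QueriesAtMost q) (hq : 6 * q ^ 2 < 2 ^ k) {g : OracleInput (k + 6) → Fin (2 ^ (k + 6))}
    (hg : ∀ I ∈ (quantumLockedEstimation (k + 6)).domain,
      (quantumLockedEstimation (k + 6)).rel I (g I) ∧ 2 / 3 ≤ A.prob I {g I})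
    {f : BitVec (k + 6) → BitVec (k + 6)} {s : BitVec (k + 6)} (hf : IsSimon f s)
    (hs : 27 * 2 ^ k ≤ s.toNat) (hs' : s.toNat < 28 * 2 ^ k) :
    2 / 3 ≤ A.prob ⟨f, halfOnes (k + 6)⟩ {g ⟨f, halfOnes (k + 6)⟩} ∧
      (g ⟨f, halfOnes (k + 6)⟩ : ℕ) < 32 * 2 ^ k := by
  classical
  set X := halfOnes (k + 6) with hX
  have hwX : hammingWeight X = 32 * 2 ^ k := card_halfOnes_eq_true k
  have hN : (2 : ℝ) ^ (k + 6) = 64 * 2 ^ k := by rw [pow_add]; ring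
  have hm : (0 : ℝ) < 2 ^ k := by positivity
  have hsR : 27 * (2 : ℝ) ^ k ≤ s.toNat := by exact_mod_cast hs
  have hsR' : (s.toNat : ℝ) < 28 * 2 ^ k := by exact_mod_cast hs'
  obtain ⟨D, hDZ, hDc, hD⟩ := exists_unlikely_queried hA hq ⟨f, X⟩ (card_halfOnes_eq_true k)
  have hones : ∀ i ∈ D, X i = true := fun i hi => (Finset.mem_filter.mp (hDZ hi)).2
  have hw : ∀ B ⊆ D, (hammingWeight (flipBits X B) : ℝ) + B.card = 32 * 2 ^ k := by
    intro B hB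
    have h := hammingWeight_flipBits_ones X fun i hi => hones i (hB hi)
    rw [hwX] at h
    exact_mod_cast h
  have hdom : ∀ B ⊆ D, (⟨f, flipBits X B⟩ : OracleInput (k + 6)) ∈
      (quantumLockedEstimation (k + 6)).domain := by
    intro B hB
    have h1 := hw B hB
    have h2 : (B.card : ℝ) ≤ 8 * 2 ^ k := by
      have := (Finset.card_le_card hB).trans_eq hDc
      exact_mod_cast this
    have h3 : (0 : ℝ) ≤ B.card := Nat.cast_nonneg _
    refine ⟨s, hf, ?_⟩
    change |(hammingWeight (flipBits X B) : ℝ) - s.toNat| ≤ _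
    rw [hN, abs_le]
    constructor <;> linarith
  have heq := canonical_flipBits_eq hA g (f := f) (X := X) (D := D)
    (fun B hB => (hg _ (hdom B hB)).2) hD
  have hX0 : flipBits X ∅ = X := by ext i; simp [flipBits]
  have hdX := hdom ∅ (Finset.empty_subset _)
  rw [hX0] at hdX
  refine ⟨(hg _ hdX).2, ?_⟩
  have hrel := (hg _ (hdom D subset_rfl)).1
  rw [heq] at hrel
  change |(hammingWeight (flipBits X D) : ℝ) - ((g ⟨f, X⟩ : ℕ) : ℝ)| ≤ _ at hrel
  have h1 := hw D subset_rfl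
  rw [hDc] at h1
  push_cast at h1
  rw [hN, abs_le] at hrel
  have h2 : ((g ⟨f, X⟩ : ℕ) : ℝ) < ((32 * 2 ^ k : ℕ) : ℝ) := by
    push_cast
    linarith [hrel.1]
  exact_mod_cast h2

/-- If the secret is above `N / 2`, then so is the canonical solution on `halfOnes`. -/
theorem half_le_canonical {k q : ℕ} {A : RandAlg (k + 6) (Fin (2 ^ (k + 6)))}
    (hA : A.QueriesAtMost q) (hq : 6 * q ^ 2 < 2 ^ k) {g : OracleInput (k + 6) → Fin (2 ^ (k + 6))}
    (hg : ∀ I ∈ (quantumLockedEstimation (k + 6)).domain,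
      (quantumLockedEstimation (k + 6)).rel I (g I) ∧ 2 / 3 ≤ A.prob I {g I})
    {f : BitVec (k + 6) → BitVec (k + 6)} {s : BitVec (k + 6)} (hf : IsSimon f s)
    (hs : 36 * 2 ^ k ≤ s.toNat) (hs' : s.toNat < 37 * 2 ^ k) :
    2 / 3 ≤ A.prob ⟨f, halfOnes (k + 6)⟩ {g ⟨f, halfOnes (k + 6)⟩} ∧
      32 * 2 ^ k ≤ (g ⟨f, halfOnes (k + 6)⟩ : ℕ) := by
  classical
  set X := halfOnes (k + 6) with hX
  have hwX : hammingWeight X = 32 * 2 ^ k := card_halfOnes_eq_true k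
  have hN : (2 : ℝ) ^ (k + 6) = 64 * 2 ^ k := by rw [pow_add]; ring
  have hm : (0 : ℝ) < 2 ^ k := by positivity
  have hsR : 36 * (2 : ℝ) ^ k ≤ s.toNat := by exact_mod_cast hs
  have hsR' : (s.toNat : ℝ) < 37 * 2 ^ k := by exact_mod_cast hs'
  obtain ⟨D, hDZ, hDc, hD⟩ := exists_unlikely_queried hA hq ⟨f, X⟩ (card_halfOnes_eq_false k)
  have hzeros : ∀ i ∈ D, X i = false := fun i hi => (Finset.mem_filter.mp (hDZ hi)).2
  have hw : ∀ B ⊆ D, (hammingWeight (flipBits X B) : ℝ) = 32 * 2 ^ k + B.card := by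
    intro B hB
    have h := hammingWeight_flipBits_zeros X fun i hi => hzeros i (hB hi)
    rw [hwX] at h
    exact_mod_cast h
  have hdom : ∀ B ⊆ D, (⟨f, flipBits X B⟩ : OracleInput (k + 6)) ∈
      (quantumLockedEstimation (k + 6)).domain := by
    intro B hB
    have h1 := hw B hB
    have h2 : (B.card : ℝ) ≤ 8 * 2 ^ k := by
      have := (Finset.card_le_card hB).trans_eq hDc
      exact_mod_cast this
    have h3 : (0 : ℝ) ≤ B.card := Nat.cast_nonneg _
    refine ⟨s, hf, ?_⟩
    change |(hammingWeight (flipBits X B) : ℝ) - s.toNat| ≤ _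
    rw [hN, abs_le]
    constructor <;> linarith
  have heq := canonical_flipBits_eq hA g (f := f) (X := X) (D := D)
    (fun B hB => (hg _ (hdom B hB)).2) hD
  have hX0 : flipBits X ∅ = X := by ext i; simp [flipBits]
  have hdX := hdom ∅ (Finset.empty_subset _)
  rw [hX0] at hdX
  refine ⟨(hg _ hdX).2, ?_⟩
  have hrel := (hg _ (hdom D subset_rfl)).1
  rw [heq] at hrel
  change |(hammingWeight (flipBits X D) : ℝ) - ((g ⟨f, X⟩ : ℕ) : ℝ)| ≤ _ at hrel
  have h1 := hw D subset_rfl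
  rw [hDc] at h1
  push_cast at h1
  rw [hN, abs_le] at hrel
  have h2 : ((32 * 2 ^ k : ℕ) : ℝ) ≤ ((g ⟨f, X⟩ : ℕ) : ℝ) := by
    push_cast
    linarith [hrel.2]
  exact_mod_cast h2

/-- A classical pseudo-deterministic algorithm with `q` queries has `q = Ω(√N)`. -/
theorem two_pow_le_of_psSolves {k q : ℕ} {A : RandAlg (k + 6) (Fin (2 ^ (k + 6)))}
    (hA : A.QueriesAtMost q) (hps : (quantumLockedEstimation (k + 6)).PsSolves A.prob) :
    2 ^ k ≤ 6 * q ^ 2 := by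
  classical
  by_contra! hq
  obtain ⟨g', hg'⟩ := hps
  set g : OracleInput (k + 6) → Fin (2 ^ (k + 6)) := fun I =>
    if h : I ∈ (quantumLockedEstimation (k + 6)).domain then g' ⟨I, h⟩
    else ⟨0, Nat.two_pow_pos _⟩ with hgdef
  have hg : ∀ I ∈ (quantumLockedEstimation (k + 6)).domain,
      (quantumLockedEstimation (k + 6)).rel I (g I) ∧ 2 / 3 ≤ A.prob I {g I} := by
    intro I hI
    have h1 : g I = g' ⟨I, hI⟩ := dif_pos hI
    rw [h1]
    exact hg' ⟨I, hI⟩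
  have hN : 2 ^ (k + 6) = 64 * 2 ^ k := by rw [pow_add]; ring
  set X := halfOnes (k + 6)
  set E : Set (Fin (2 ^ (k + 6))) := {t | (t : ℕ) < 32 * 2 ^ k} with hE
  have hlow : ∀ s ∈ secretWindow (k + 6) (27 * 2 ^ k) (28 * 2 ^ k), ∀ σ,
      A.prob ⟨simonFun σ s, X⟩ Eᶜ ≤ 1 / 3 := by
    intro s hs σ
    obtain ⟨h1, h2⟩ := toNat_of_mem_secretWindow (by omega) hs
    obtain ⟨h3, h4⟩ := canonical_lt_half hA hq hg (isSimon_simonFun σ s) h1 h2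
    have h5 := A.prob_add_prob_le ⟨simonFun σ s, X⟩ (E := Eᶜ) (F := {g ⟨simonFun σ s, X⟩})
      (by rw [Set.disjoint_singleton_right]; exact fun h => h h4)
    linarith
  have hhigh : ∀ s ∈ secretWindow (k + 6) (36 * 2 ^ k) (37 * 2 ^ k), ∀ σ,
      A.prob ⟨simonFun σ s, X⟩ E ≤ 1 / 3 := by
    intro s hs σ
    obtain ⟨h1, h2⟩ := toNat_of_mem_secretWindow (by omega) hs
    obtain ⟨h3, h4⟩ := half_le_canonical hA hq hg (isSimon_simonFun σ s) h1 h2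
    have h5 := A.prob_add_prob_le ⟨simonFun σ s, X⟩ (E := E) (F := {g ⟨simonFun σ s, X⟩})
      (by rw [Set.disjoint_singleton_right]; exact fun h => absurd h4 (not_le.mpr h))
    linarith
  have h1 := sum_prob_perm_le hA X Eᶜ _ hlow
  have h2 := sum_prob_perm_le hA X E _ hhigh
  rw [card_secretWindow (by omega), show 28 * 2 ^ k - 27 * 2 ^ k = 2 ^ k by omega] at h1
  rw [card_secretWindow (by omega), show 37 * 2 ^ k - 36 * 2 ^ k = 2 ^ k by omega] at h2
  have h3 : (Fintype.card (Equiv.Perm (BitVec (k + 6))) : ℝ) ≤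
      ∑ σ : Equiv.Perm (BitVec (k + 6)), A.prob ⟨σ, X⟩ E +
        ∑ σ : Equiv.Perm (BitVec (k + 6)), A.prob ⟨σ, X⟩ Eᶜ := by
    rw [← Finset.sum_add_distrib, ← Finset.card_univ, ← nsmul_one, ← Finset.sum_const]
    exact Finset.sum_le_sum fun σ _ => A.one_le_prob_add_prob_compl _ _
  have hP : (0 : ℝ) < Fintype.card (Equiv.Perm (BitVec (k + 6))) := by
    exact_mod_cast Fintype.card_pos
  have hm : (0 : ℝ) < 2 ^ k := by positivity
  have hqR : 6 * (q : ℝ) ^ 2 < 2 ^ k := by exact_mod_cast hq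
  push_cast at h1 h2
  have h4 := mul_le_mul_of_nonneg_left h3 hm.le
  rw [mul_add] at h4
  have h5 := mul_lt_mul_of_pos_right hqR hP
  nlinarith

theorem sqrt_two_pow_le_psR {n : ℕ} (hn : 6 ≤ n) :
    ENNReal.ofReal (1 / 20 * √((2 : ℝ) ^ n)) ≤ ((quantumLockedEstimation n).psR : ℝ≥0∞) := by
  obtain ⟨k, rfl⟩ := Nat.exists_eq_add_of_le' hn
  have h : ((⌈1 / 20 * √((2 : ℝ) ^ (k + 6))⌉₊ : ℕ) : ℕ∞) ≤
      (quantumLockedEstimation (k + 6)).psR := by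
    refine le_iInf₂ fun q hq => ?_
    obtain ⟨A, hA, hps⟩ := hq
    have h1 : (2 : ℝ) ^ k ≤ 6 * q ^ 2 := by exact_mod_cast two_pow_le_of_psSolves hA hps
    rw [Nat.cast_le, Nat.ceil_le]
    have h2 : √((2 : ℝ) ^ (k + 6)) ≤ 20 * q := by
      rw [Real.sqrt_le_left (by positivity), pow_add]
      nlinarith
    linarith
  have h2 := ENat.toENNReal_mono h
  rw [ENat.toENNReal_coe] at h2
  refine le_trans ?_ h2
  rw [ENNReal.ofReal_le_iff_le_toReal (ENNReal.natCast_ne_top _), ENNReal.toReal_natCast]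
  exact Nat.le_ceil _

end
theorem theorem7 :
    -- the randomized query complexity is `O(1)`
    (∃ C : ℕ, ∀ n : ℕ, (quantumLockedEstimation n).R ≤ (C : ℕ∞)) ∧
    -- the pseudo-deterministic quantum query complexity is `O(log N)`, where `log N = n`
    (∃ C : ℕ, ∀ n : ℕ, (quantumLockedEstimation n).psQ ≤ ((C * n : ℕ) : ℕ∞)) ∧
    -- the classical pseudo-deterministic query complexity is `Ω(√N)`
    (∃ c : ℝ, 0 < c ∧ ∀ᶠ n : ℕ in atTop,
      ENNReal.ofReal (c * √((2 : ℝ) ^ n)) ≤ ((quantumLockedEstimation n).psR : ℝ≥0∞)) ∧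
    -- some `O(log N)`-query randomized algorithm is canonized by an `O(log N)`-query
    -- pseudo-deterministic quantum algorithm
    (∃ C : ℕ, ∀ n : ℕ,
      ∃ (A : RandAlg n (Fin (2 ^ n))) (B : QuantumAlg n (Fin (2 ^ n))),
        A.QueriesAtMost (C * n) ∧
        (quantumLockedEstimation n).Solves A.prob ∧
        B.queries ≤ C * n ∧
        (quantumLockedEstimation n).PsSolves B.prob ∧
        (quantumLockedEstimation n).Canonizes B A) := by
  refine ⟨⟨640000, fun n => ?_⟩, ⟨3, fun n => ?_⟩, ⟨1 / 20, by norm_num, ?_⟩,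
    ⟨640000, fun n => ⟨samplingAlg n (640000 * n), simonAlg n (3 * n),
      samplingAlg_queriesAtMost n _, samplingAlg_solves_linear n, ?_,
      ⟨_, simonAlg_psSolvesWith n⟩,
      ⟨_, simonAlg_psSolvesWith n, secret_funCanonizes_samplingAlg n⟩⟩⟩⟩
  · exact iInf₂_le 640000
      ⟨samplingAlg n 640000, samplingAlg_queriesAtMost n _, samplingAlg_solves_const n⟩
  · exact iInf₂_le (3 * n)
      ⟨simonAlg n (3 * n), (simonAlg_queries n _).le, ⟨_, simonAlg_psSolvesWith n⟩⟩
  · filter_upwards [eventually_ge_atTop 6] with n hn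
    exact sqrt_two_pow_le_psR hn
  · rw [simonAlg_queries]
    exact Nat.mul_le_mul_right n (by norm_num)
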